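/- **Setting.** Let $\Omega$ be a family of subsets of $\mathbb R^3$, closed under the translations $T_y\omega=\{z-y : z\in\omega\}$, satisfying the following geometric conditions. (G1) For each $\omega\in\Omega$ the set $\mathbb R^3\setminus\omega$ is connected, and $\omega=\bigsqcup_{k\in\mathbb N}\omega^k$ with $\omega^k$ (the inclusions) nonempty, open and connected, and there are bounded open sets $\mathcal B^k_\omega$ such that $\omega\cap\mathcal B^k_\omega=\omega^k$, $\mathcal B^k_\omega\setminus\overline{\omega^k}$ has Lipschitz boundary, $\operatorname{diam}\omega^k<\frac12$, and $\mathcal B_\omega^k-D_\omega^k-(\frac14,\frac14,\frac14)\subset[-\frac12,\frac12]^3$, where $(D^k_\omega)_j=\inf_{x\in\omega^k}x_j$. (G2) There are finitely many triples $(P_1^j,P_2^j,P_3^j)$ of Lipschitz domains with $\overline{P_1^j}\subset P_2^j$, $\overline{P_2^j}\subset P_3^j$ and $P_2^j\setminus\overline{P_1^j}$ Lipschitz, and constants $c,C,\tilde C>0$, such that for all $\omega\in\Omega$ and $k\in\mathbb N$ there are an index $j$, an open neighbourhood $\widetilde{\mathcal B}$ of $\mathcal B^k_\omega$ with Lipschitz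 boundary, and a $C^2$ diffeomorphism $\varphi:P_3^j\to\widetilde{\mathcal B}$ with $\varphi(P_3^j\setminus P_2^j)=\widetilde{\mathcal B}\setminus\mathcal B^k_\omega$, $\varphi(P_2^j\setminus P_1^j)=\mathcal B^k_\omega\setminus\omega^k$, $\varphi(P_1^j)=\omega^k$, $c|x-y|\le|\varphi(x)-\varphi(y)|\le C|x-y|$, and $\|\varphi-t\|_{C^2(P_3^j)}\le\tilde C$ for some vector $t\in\mathbb R^3$. Equip $\Omega$ with the $\sigma$-algebra $\mathcal F$ generated by the maps $\omega\mapsto\mathbf 1_\omega(q)$, $q\in\mathbb Q^3$, and with a probability measure $P$ which is invariant and ergodic under $(T_y)_{y\in\mathbb R^3}$. Assume that, almost surely, every inclusion is obtained by a rotation and a translation from one of finitely many fixed shapes. Let $\mathsf C_0=((\mathsf C_0)_{\alpha\beta\mu\nu})$ be a constant real tensor with $(\mathsf C_0)_{\alpha\beta\mu\nu}=(\mathsf C_0)_{\mu\nu\alpha\beta}=(\mathsf C_0)_{\alpha\beta\nu\mu}$, with $\mathsf C_0\xi\cdot\xi\ge c_0|\xi|^2$ for some $c_0>0$ and all symmetric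 $\xi$, and isotropic: $\mathsf C_0\xi=c_1(\operatorname{tr}\xi)I+c_2\operatorname{sym}\xi$ for some $c_1,c_2\in\mathbb R$ and all matrices $\xi$. For $\overline{f}\in L^2(\Omega;\mathbb R^3)$ let $f(y,\omega)=\overline{f}(T_y\omega)$. Let $\mathbf H^1(\Omega)$ be the space of those $\overline{f}\in L^2(\Omega;\mathbb R^3)$ for which there are $\overline{g_1},\overline{g_2},\overline{g_3}\in L^2(\Omega;\mathbb R^3)$ such that almost surely $g_\mu(\cdot,\omega)$ is the weak derivative $\partial_{y_\mu} f(\cdot,\omega)$ for $\mu=1,2,3$. Let $\mathbf L^2_0(\Omega)$ be the space of those $\overline{f}\in L^2(\Omega;\mathbb R^3)$ whose realisations $f(\cdot,\omega)$ vanish outside $\omega$, and put $\mathbf H^1_0(\Omega)=\mathbf H^1(\Omega)\cap\mathbf L^2_0(\Omega)$. Let $\mathcal A_0$ be the self-adjoint operator in $\mathbf L^2_0(\Omega)$ associated with the form $$\mathbb E[\mathsf C_0\nabla_y u\cdot\nabla_y v]=\mathbb E[(\mathsf C_0)_{\alpha\beta\mu\nu}\,\partial_\mu u_\nu\,\partial_\alpha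 v_\beta],\qquad \overline u,\overline v\in\mathbf H^1_0(\Omega).$$ For $\lambda\in[0,\infty)\setminus\sigma(\mathcal A_0)$ let $\overline{b^{(i)}_\lambda}\in\mathbf H^1_0(\Omega)$, $i=1,2,3$, be the unique solution of $\mathcal A_0\overline{b^{(i)}_\lambda}=\lambda\overline{b^{(i)}_\lambda}+\mathbf e_i$, that is, $$\mathbb E[\mathsf C_0\nabla_y b^{(i)}_\lambda\cdot\nabla_y v]=\lambda\,\mathbb E[\overline{b^{(i)}_\lambda}\cdot \overline v]+\mathbb E[\mathbf e_i\cdot\overline v]\qquad\text{for all }\overline v\in\mathbf H^1_0(\Omega).$$ Let $\overline{\mathbf b_\lambda}$ be the matrix with columns $\overline{b^{(1)}_\lambda},\overline{b^{(2)}_\lambda},\overline{b^{(3)}_\lambda}$, and define the Zhikov $\boldsymbol\beta$-matrix by $\boldsymbol\beta(\lambda)=\mathbb E[\lambda I+\lambda^2\overline{\mathbf b_\lambda}]$. Let $\omega^0$ be the connected component of $\omega$ containing the origin ($\omega^0=\emptyset$ if $0\notin\omega$), let $\mathcal H$ be the Borel $\sigma$-algebra of the Hausdorff distance on sets, let $S_j$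 be the reflection across the plane $\{x_j=0\}$, and let $R_j$ be the counterclockwise rotation by $\pi/2$ about the $x_j$-axis, $j=1,2,3$. **Proposition.** Let $\lambda\in[0,\infty)\setminus\sigma(\mathcal A_0)$. (a) If $P(\omega^0\in\mathfrak H)=P(\omega^0\in S_j\mathfrak H)$ for all $\mathfrak H\in\mathcal H$ and $j\in\{1,2,3\}$, then $\boldsymbol\beta(\lambda)$ is diagonal. (b) If $P(\omega^0\in\mathfrak H)=P(\omega^0\in R_j\mathfrak H)$ for all $\mathfrak H\in\mathcal H$ and $j\in\{1,2,3\}$, then $\boldsymbol\beta(\lambda)$ is a scalar multiple of the identity matrix. Here $S_j\mathfrak H$ and $R_j\mathfrak H$ are obtained by applying the isometry to each element of $\mathfrak H$. -/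

import Mathlib

open scoped ContDiff

noncomputable section

namespace RandomElasticity

open MeasureTheory

/-- Euclidean space of dimension three. -/
abbrev E3 : Type := EuclideanSpace ℝ (Fin 3)

/-- The standard basis vectors. -/
def stdVec (i : Fin 3) : E3 := EuclideanSpace.single i (1 : ℝ)

/-- A matrix acting on points of Euclidean space. -/
def matAct (M : Matrix (Fin 3) (Fin 3) ℝ) (x : E3) : E3 := WithLp.toLp 2 (M.mulVec x.ofLp)

/-! ### Geometry of the inclusions -/

/-- Near each boundary point, after a rigid change of coordinates, the set is the region strictly
above the graph of a Lipschitz function of the first two coordinates. -/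
def HasLipschitzBoundary (U : Set E3) : Prop :=
  ∀ p ∈ frontier U, ∃ (r : ℝ) (K : NNReal) (L : E3 ≃ₗᵢ[ℝ] E3)
    (γ : EuclideanSpace ℝ (Fin 2) → ℝ), 0 < r ∧ LipschitzWith K γ ∧
      ∀ x ∈ Metric.ball p r, x ∈ U ↔ γ (WithLp.toLp 2 ![L x 0, L x 1]) < L x 2

/-- An open set with Lipschitz boundary. -/
def IsLipschitzOpen (U : Set E3) : Prop := IsOpen U ∧ HasLipschitzBoundary U

/-- A Lipschitz domain: open, connected, with Lipschitz boundary. -/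
def IsLipschitzDomain (U : Set E3) : Prop :=
  IsOpen U ∧ IsConnected U ∧ HasLipschitzBoundary U

/-- The decomposition of one set `w` into inclusions `inc k` with extension domains `B k`. -/
structure IsInclusionDecomposition (w : Set E3) (inc B : ℕ → Set E3) : Prop where
  compl_connected : IsConnected wᶜ
  union : w = ⋃ k, inc k
  disjoint : Pairwise fun k l => Disjoint (inc k) (inc l)
  inc_open : ∀ k, IsOpen (inc k)
  inc_connected : ∀ k, IsConnected (inc k)
  B_open : ∀ k, IsOpen (B k)
  B_bounded : ∀ k, Bornology.IsBounded (B k)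
  inter : ∀ k, w ∩ B k = inc k
  shell_lipschitz : ∀ k, IsLipschitzOpen (B k \ closure (inc k))
  diam_lt : ∀ k, Metric.diam (inc k) < 1 / 2
  /-- After subtracting the vector of coordinatewise infima of the inclusion and `1/4` from every
  coordinate, the extension domain lies in the unit cube centred at the origin. -/
  box : ∀ k, ∀ x ∈ B k, ∀ j : Fin 3,
    x j - sInf ((fun z : E3 => z j) '' inc k) - 1 / 4 ∈ Set.Icc (-(1 / 2) : ℝ) (1 / 2)

/-- The triple `(w, B, B')` (inclusion, extension domain, larger neighbourhood) is the image of the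
reference triple `(P1, P2, P3)` under a `C²` diffeomorphism which is bi-Lipschitz with constants
`c`, `C` and whose `C²` norm, up to subtraction of a constant vector, is at most `D`. -/
def IsModelledOn (P1 P2 P3 : Set E3) (c C D : ℝ) (w B B' : Set E3) : Prop :=
  ∃ φ ψ : E3 → E3,
    ContDiffOn ℝ 2 φ P3 ∧ ContDiffOn ℝ 2 ψ B' ∧ Set.InvOn ψ φ P3 B' ∧ φ '' P3 = B' ∧
    φ '' (P3 \ P2) = B' \ B ∧ φ '' (P2 \ P1) = B \ w ∧ φ '' P1 = w ∧
    (∀ x ∈ P3, ∀ y ∈ P3, c * dist x y ≤ dist (φ x) (φ y) ∧ dist (φ x) (φ y) ≤ C * dist x y) ∧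
    ∃ t : E3, ∀ n : ℕ, n ≤ 2 → ∀ x ∈ P3, ‖iteratedFDeriv ℝ n (fun z => φ z - t) x‖ ≤ D

/-- The geometric conditions on the family of all admissible configurations, with finitely many
reference triples and constants which do not depend on the configuration or on the inclusion. -/
def UniformGeometry (Ω : Set (Set E3)) : Prop :=
  ∃ (N : ℕ) (P1 P2 P3 : Fin N → Set E3) (c C D : ℝ), 0 < c ∧ 0 < C ∧ 0 < D ∧
    (∀ j, IsLipschitzDomain (P1 j) ∧ IsLipschitzDomain (P2 j) ∧ IsLipschitzDomain (P3 j) ∧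
      closure (P1 j) ⊆ P2 j ∧ closure (P2 j) ⊆ P3 j ∧
      IsLipschitzOpen (P2 j \ closure (P1 j))) ∧
    ∀ w ∈ Ω, ∃ inc B : ℕ → Set E3, IsInclusionDecomposition w inc B ∧
      ∀ k, ∃ (j : Fin N) (B' : Set E3), IsLipschitzOpen B' ∧ B k ⊆ B' ∧
        IsModelledOn (P1 j) (P2 j) (P3 j) c C D (inc k) (B k) B'

/-- The translate `{z - y | z ∈ w}` of a set of inclusions. -/
def translateSet (y : E3) (w : Set E3) : Set E3 := (fun z => z - y) '' w

/-- A translation-invariant family of sets of inclusions subject to the geometric conditions. -/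
structure InclusionSpace where
  sets : Set (Set E3)
  translate_mem : ∀ (y : E3), ∀ w ∈ sets, translateSet y w ∈ sets
  geometry : UniformGeometry sets

/-- The sample space: its points are the sets of inclusions belonging to the family. -/
def InclusionSpace.Config (X : InclusionSpace) : Type := {w : Set E3 // w ∈ X.sets}

/-- The set of inclusions which is the given sample point. -/
def InclusionSpace.Config.set {X : InclusionSpace} (w : X.Config) : Set E3 := w.1

/-- The points of Euclidean space with rational coordinates. -/
def ratPoint (q : Fin 3 → ℚ) : E3 := WithLp.toLp 2 fun i => (q i : ℝ)

/-- The σ-algebra generated by the evaluations `w ↦ 1_w(q)` at rational points `q`. -/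
instance (X : InclusionSpace) : MeasurableSpace X.Config :=
  MeasurableSpace.generateFrom
    {A | ∃ q : Fin 3 → ℚ, A = {w : X.Config | ratPoint q ∈ w.set}}

/-- The action of translations on the sample space. -/
def InclusionSpace.shift (X : InclusionSpace) (y : E3) (w : X.Config) : X.Config :=
  ⟨translateSet y w.1, X.translate_mem y w.1 w.2⟩

variable {X : InclusionSpace}

/-- Invariance of the law under translations. -/
def IsStationaryLaw (P : Measure X.Config) : Prop :=
  ∀ (y : E3) (F : Set X.Config), MeasurableSet F → P (X.shift y '' F) = P F

/-- Ergodicity of the action of translations. -/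
def IsErgodic (P : Measure X.Config) : Prop :=
  ∀ F : Set X.Config, MeasurableSet F →
    (∀ y : E3, P (symmDiff (X.shift y '' F) F) = 0) → P F = 0 ∨ P F = 1

/-! ### Inclusion at the origin and statistical micro-symmetries -/

/-- Almost surely all inclusions (connected components) are obtained from finitely many shapes by
rotations and translations. -/
def FinitelyManyShapes (P : Measure X.Config) : Prop :=
  ∃ S : Set (Set E3), S.Finite ∧ ∀ᵐ w ∂P, ∀ x ∈ w.set, ∃ Q ∈ S,
    ∃ R ∈ Matrix.specialOrthogonalGroup (Fin 3) ℝ, ∃ t : E3,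
      connectedComponentIn w.set x = (fun z => matAct R z + t) '' Q

/-- The inclusion containing the origin; it is empty if the origin lies in no inclusion. -/
def originInclusion (w : X.Config) : Set E3 := connectedComponentIn w.set 0

/-- The Borel σ-algebra of the Hausdorff distance on sets. -/
@[reducible] def hausdorffBorel : MeasurableSpace (Set E3) :=
  @borel (Set E3)
    (PseudoEMetricSpace.hausdorff (α := E3)).toUniformSpace.toTopologicalSpace

/-- The law of the inclusion at the origin is invariant under the action of `M` on sets. -/
def HasMicroSymmetry (P : Measure X.Config) (M : Matrix (Fin 3) (Fin 3) ℝ) : Prop :=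
  ∀ H : Set (Set E3), MeasurableSet[hausdorffBorel] H →
    P {w | originInclusion w ∈ H} =
      P {w | originInclusion w ∈ (fun K : Set E3 => matAct M '' K) '' H}

/-- The reflection across the plane `x_j = 0`. -/
def reflection (j : Fin 3) : Matrix (Fin 3) (Fin 3) ℝ :=
  Matrix.diagonal fun i => if i = j then -1 else 1

/-- The counterclockwise rotation by `π / 2` about the `x_j` axis. -/
def quarterTurn : Fin 3 → Matrix (Fin 3) (Fin 3) ℝ :=
  ![!![1, 0, 0; 0, 0, -1; 0, 1, 0],
    !![0, 0, 1; 0, 1, 0; -1, 0, 0],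
    !![0, -1, 0; 1, 0, 0; 0, 0, 1]]

/-! ### Elasticity tensors -/

/-- Fourth-order tensors. -/
abbrev Tensor4 : Type := Fin 3 → Fin 3 → Fin 3 → Fin 3 → ℝ

/-- The action of a fourth-order tensor on matrices. -/
def Tensor4.act (C : Tensor4) (ξ : Matrix (Fin 3) (Fin 3) ℝ) : Matrix (Fin 3) (Fin 3) ℝ :=
  Matrix.of fun a b => ∑ m, ∑ n, C a b m n * ξ m n

/-- The symmetry and ellipticity conditions on the tensor of coefficients. -/
def Tensor4.IsElastic (C : Tensor4) : Prop :=
  (∀ a b m n, C a b m n = C m n a b) ∧ (∀ a b m n, C a b m n = C a b n m) ∧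
  ∃ c : ℝ, 0 < c ∧ ∀ ξ : Matrix (Fin 3) (Fin 3) ℝ, ξ.IsSymm →
    c * ∑ a, ∑ b, ξ a b ^ 2 ≤ ∑ a, ∑ b, C.act ξ a b * ξ a b

/-- Isotropy: `C ξ = c₁ (tr ξ) I + c₂ sym ξ`. -/
def Tensor4.IsIsotropic (C : Tensor4) : Prop :=
  ∃ c1 c2 : ℝ, ∀ ξ : Matrix (Fin 3) (Fin 3) ℝ,
    C.act ξ = (c1 * ξ.trace) • (1 : Matrix (Fin 3) (Fin 3) ℝ) +
      c2 • ((1 / 2 : ℝ) • (ξ + ξ.transpose))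

/-! ### Function spaces on the sample space -/

/-- Square-integrable random vector fields. -/
abbrev L2 (P : Measure X.Config) : Type := Lp E3 2 P

/-- The square-integrable random fields whose realisation `y ↦ f (T_y w)` vanishes outside `w`.
Since `y ∉ w` if and only if `0 ∉ T_y w`, this says that `f` vanishes when the origin lies in no
inclusion. -/
def L2zero (P : Measure X.Config) : Submodule ℝ (L2 P) where
  carrier := {f | ∀ᵐ w ∂P, (0 : E3) ∉ w.set → f w = 0}
  zero_mem' := by
    filter_upwards [Lp.coeFn_zero E3 2 P] with w hw _ using by simpa using hw
  add_mem' := by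
    intro f g hf hg
    change ∀ᵐ w ∂P, (0 : E3) ∉ w.set → (f + g : L2 P) w = 0
    filter_upwards [Lp.coeFn_add f g, hf, hg] with w hw h1 h2 h0
    rw [hw, Pi.add_apply, h1 h0, h2 h0, add_zero]
  smul_mem' := by
    intro a f hf
    change ∀ᵐ w ∂P, (0 : E3) ∉ w.set → (a • f : L2 P) w = 0
    filter_upwards [Lp.coeFn_smul a f, hf] with w hw h1 h0
    rw [hw, Pi.smul_apply, h1 h0, smul_zero]

/-- `G m` is the partial derivative in the direction `m` of the random field `f`: almost surely
the realisation `y ↦ G m (T_y w)` is the weak derivative of the realisation `y ↦ f (T_y w)`.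
A field `f` belongs to `H¹(Ω)` if it has such a (square-integrable) gradient `G`. -/
def HasGrad (P : Measure X.Config) (f : L2 P) (G : Fin 3 → L2 P) : Prop :=
  ∀ᵐ w ∂P, ∀ φ : E3 → ℝ, ContDiff ℝ ∞ φ → HasCompactSupport φ → ∀ m : Fin 3,
    ∫ y : E3, (fderiv ℝ φ y (stdVec m)) • f (X.shift y w) =
      - ∫ y : E3, φ y • G m (X.shift y w)

/-- The form `E[C ∇u · ∇v] = E[C_{abmn} ∂_m u_n ∂_a v_b]`, in terms of the gradients `G` of `u`
and `V` of `v`. -/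
def form (P : Measure X.Config) (C : Tensor4) (G V : Fin 3 → L2 P) : ℝ :=
  ∫ w, ∑ a, ∑ b, ∑ m, ∑ n, C a b m n * (G m w) n * (V a w) b ∂P

/-! ### The operator in the inclusions, its spectrum, and the effective matrix -/

/-- The graph of the operator `A₀` in `L²₀(Ω)` associated with the form on `H¹₀(Ω)`: `u` is in the
domain and `A₀ u = f` if and only if `u ∈ H¹₀(Ω)` and `E[C ∇u · ∇v] = E[f · v]` for all
`v ∈ H¹₀(Ω)`. -/
def MicroOperator (P : Measure X.Config) (C : Tensor4) (u f : L2zero P) : Prop :=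
  ∃ G : Fin 3 → L2 P, HasGrad P (u : L2 P) G ∧
    ∀ (v : L2zero P) (V : Fin 3 → L2 P), HasGrad P (v : L2 P) V →
      form P C G V = inner ℝ (f : L2 P) (v : L2 P)

/-- The resolvent set: `A₀ - lam` is a bijection from its domain onto `L²₀(Ω)` and has a bounded
inverse `R`. -/
def microResolventSet (P : Measure X.Config) (C : Tensor4) : Set ℝ :=
  {lam | ∃ R : L2zero P →L[ℝ] L2zero P,
    ∀ u f : L2zero P, MicroOperator P C u (f + lam • u) ↔ u = R f}

/-- The spectrum of `A₀` (which is contained in the real line, as `A₀` is self-adjoint). -/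
def microSpectrum (P : Measure X.Config) (C : Tensor4) : Set ℝ := (microResolventSet P C)ᶜ

/-- `u ∈ H¹₀(Ω)` is a weak solution of `A₀ u = lam u + e_i`. -/
def IsCellSolution (P : Measure X.Config) (C : Tensor4) (lam : ℝ) (i : Fin 3)
    (u : L2zero P) : Prop :=
  ∃ G : Fin 3 → L2 P, HasGrad P (u : L2 P) G ∧
    ∀ (v : L2zero P) (V : Fin 3 → L2 P), HasGrad P (v : L2 P) V →
      form P C G V = lam * inner ℝ (u : L2 P) (v : L2 P) + ∫ w, inner ℝ (stdVec i) ((v : L2 P) w) ∂P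

theorem measurableSet_zero_mem : MeasurableSet {w : X.Config | (0 : E3) ∈ w.set} := by
  refine MeasurableSpace.measurableSet_generateFrom ⟨0, ?_⟩
  have h : ratPoint 0 = 0 := by
    ext i
    simp [ratPoint]
  rw [h]

/-- For `lam` outside the spectrum the equation `A₀ u = lam u + e_i` has exactly one solution. -/
theorem existsUnique_isCellSolution (P : Measure X.Config) [IsProbabilityMeasure P] (C : Tensor4)
    {lam : ℝ} (hlam : lam ∉ microSpectrum P C) (i : Fin 3) :
    ∃! u : L2zero P, IsCellSolution P C lam i u := by
  have hlam' : lam ∈ microResolventSet P C := by simpa [microSpectrum] using hlam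
  obtain ⟨R, hR⟩ := hlam'
  have hm := measurableSet_zero_mem (X := X)
  let f0 : L2 P := indicatorConstLp 2 hm (measure_ne_top P _) (stdVec i)
  have hf0 : f0 ∈ L2zero P := by
    change ∀ᵐ w ∂P, (0 : E3) ∉ w.set → f0 w = 0
    filter_upwards [indicatorConstLp_coeFn_notMem (p := 2) (hs := hm)
      (hμs := measure_ne_top P _) (c := stdVec i)] with w hw h0
    exact hw h0
  let f : L2zero P := ⟨f0, hf0⟩
  have key : ∀ v : L2zero P,
      inner ℝ f0 (v : L2 P) = ∫ w, inner ℝ (stdVec i) ((v : L2 P) w) ∂P := by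
    intro v
    rw [L2.inner_indicatorConstLp_eq_setIntegral_inner]
    refine setIntegral_eq_integral_of_ae_compl_eq_zero ?_
    have hv : ∀ᵐ w ∂P, (0 : E3) ∉ w.set → (v : L2 P) w = 0 := v.2
    filter_upwards [hv] with w hw h0
    rw [hw h0, inner_zero_right]
  have iff : ∀ u : L2zero P, IsCellSolution P C lam i u ↔ u = R f := by
    intro u
    rw [← hR u f]
    unfold IsCellSolution MicroOperator
    refine exists_congr fun G => and_congr_right fun _ => ?_
    refine forall_congr' fun v => forall_congr' fun V => imp_congr_right fun _ => ?_
    have e : inner ℝ ((f + lam • u : L2zero P) : L2 P) (v : L2 P) =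
        lam * inner ℝ (u : L2 P) (v : L2 P) + ∫ w, inner ℝ (stdVec i) ((v : L2 P) w) ∂P := by
      rw [← key v, Submodule.coe_add, Submodule.coe_smul, inner_add_left, real_inner_smul_left]
      exact add_comm _ _
    rw [e]
  exact ⟨R f, (iff _).2 rfl, fun u hu => (iff u).1 hu⟩

open Classical in
/-- The solution `b^{(i)}` of `A₀ b = lam b + e_i` (zero if there is none, which does not happen
for `lam` outside the spectrum). -/
def cellSolution (P : Measure X.Config) (C : Tensor4) (lam : ℝ) (i : Fin 3) : L2zero P :=
  if h : ∃ u : L2zero P, IsCellSolution P C lam i u then h.choose else 0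

/-- The matrix `β(lam) = E[lam I + lam² b]`, where the `i`-th column of `b` is `b^{(i)}`. -/
def betaMatrix (P : Measure X.Config) (C : Tensor4) (lam : ℝ) : Matrix (Fin 3) (Fin 3) ℝ :=
  Matrix.of fun j i => ∫ w, (lam * (1 : Matrix (Fin 3) (Fin 3) ℝ) j i +
    lam ^ 2 * ((cellSolution P C lam i : L2 P) w) j) ∂P

end RandomElasticity

end

open RandomElasticity MeasureTheory

noncomputable section

namespace RandomElasticity

open MeasureTheory Set Metric

section

/-! ### Topology of the inclusions -/

/-! The entry of the matrix in row `j` and column `i` is determined by the mean response `E[e_j ·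
R(1_{0∈ω} e_i)]`, where `R` is the resolvent at `lam`. It is enough to show that this bilinear
expression does not change when both vectors are rotated by an isometry `L` that preserves the law
of the inclusion ω⁰ at the origin (`meanResponse_isometry`). Reflections and quarter turns then
force the off-diagonal entries, and the differences of diagonal entries, to vanish.

Neither the family of configurations nor `P` is invariant under `L`, so configurations cannot be
rotated. Instead `L` acts on fields: take the conditional expectation of `u` given ω⁰, evaluate it
at `L ω⁰`, and apply `L⁻¹` to the value (`symmField`). This operator has the one for `L⁻¹` as its
adjoint, maps the constant `c` in the inclusions to the constant `L⁻¹ c`, and preserves H¹₀. By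
isotropy it is also adjoint to the one for `L⁻¹` with respect to the form (`form_symmGrad`). Hence
it carries a solution of `A₀ u = f` to a solution for the transformed load, and uniqueness for the
resolvent gives the invariance.

The difficult point is that H¹₀ is preserved, because conditioning on ω⁰ looks incompatible with
translations. It is compatible inside one inclusion: if `y ∈ ω⁰`, the inclusion at the origin of
`T_y ω` is `ω⁰ - y`, a function of ω⁰. The derivative is therefore tested only through the pairings
`E[1_{y∈ω⁰} g(ω) · u(T_y ω)]`, for which `shiftPairing_symmetrise` is a change of variables. A
gradient yields a local gradient by a cutoff between inclusions, which are uniformly separated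
(`HasGrad.ae_isLocalGradAt`). Conversely, a countable dense set of test functions and stationarity
recover a gradient in all inclusions at once (`IsWeakLocalGrad.hasGrad`).

Measurability rests on every inclusion being the interior of its closure. Configurations can then be
read off from rational points, and a σ-algebra that sees sets only up to closure suffices to
determine the law of ω⁰. -/

theorem HasLipschitzBoundary.interior_closure {U : Set E3} (hU : IsOpen U)
    (h : HasLipschitzBoundary U) : interior (closure U) = U := by
  refine Subset.antisymm (fun p hp => ?_) (interior_maximal subset_closure hU)
  by_contra hpU
  have hpf : p ∈ frontier U := ⟨interior_subset hp, by rwa [hU.interior_eq]⟩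
  obtain ⟨r, K, L, γ, hr, hγ, hloc⟩ := h p hpf
  have hγp : L p 2 ≤ γ (WithLp.toLp 2 ![L p 0, L p 1]) := by
    by_contra hlt
    exact hpU ((hloc p (mem_ball_self hr)).2 (not_le.1 hlt))
  -- Moving a little from `p` against the graph direction stays in the interior of the closure but
  -- goes strictly below the graph, where a whole neighbourhood misses `U`.
  set v : E3 := L.symm (stdVec 2) with hv
  have hLv : L v = stdVec 2 := by simp [hv]
  have hcont : Continuous fun t : ℝ => p - t • v := by fun_prop
  have hnhds : ∀ᶠ t in nhdsWithin (0 : ℝ) (Ioi 0), p - t • v ∈ interior (closure U) ∩ ball p r := by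
    refine nhdsWithin_le_nhds (hcont.continuousAt.eventually_mem ?_)
    refine (isOpen_interior.inter isOpen_ball).mem_nhds ?_
    simpa using ⟨hp, hr⟩
  obtain ⟨t, ⟨ht1, ht2⟩, ht0⟩ := (hnhds.and self_mem_nhdsWithin).exists
  have ht0 : 0 < t := ht0
  have hγc : Continuous fun x : E3 => γ (WithLp.toLp 2 ![L x 0, L x 1]) - L x 2 := by
    refine (hγ.continuous.comp ?_).sub (by fun_prop)
    refine (PiLp.continuous_toLp 2 _).comp (continuous_pi fun i => ?_)
    fin_cases i <;> simp <;> fun_prop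
  have hval : 0 < γ (WithLp.toLp 2 ![L (p - t • v) 0, L (p - t • v) 1]) - L (p - t • v) 2 := by
    simp [hLv, stdVec]
    linarith
  have hopen : IsOpen ({x : E3 | 0 < γ (WithLp.toLp 2 ![L x 0, L x 1]) - L x 2} ∩ ball p r) :=
    (isOpen_lt continuous_const hγc).inter isOpen_ball
  obtain ⟨z, ⟨hz1, hz2⟩, hz3⟩ := mem_closure_iff.1 (interior_subset ht1) _ hopen ⟨hval, ht2⟩
  have := (hloc z hz2).1 hz3
  simp only [mem_ofPred_eq] at hz1
  linarith

/-- Locally the frontier lies in a closed graph, and a graph has infinitely many disjoint translates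
along a bounded sequence of vertical vectors, so it is null. -/
theorem HasLipschitzBoundary.volume_frontier {U : Set E3} (hU : IsOpen U)
    (h : HasLipschitzBoundary U) : volume (frontier U) = 0 := by
  refine measure_null_of_locally_null _ fun p hp => ?_
  obtain ⟨r, K, L, γ, hr, hγ, hloc⟩ := h p hp
  refine ⟨frontier U ∩ ball p r, inter_mem_nhdsWithin _ (ball_mem_nhds p hr), ?_⟩
  have hγc : Continuous fun x : E3 => γ (WithLp.toLp 2 ![L x 0, L x 1]) := by
    refine hγ.continuous.comp ?_
    refine (PiLp.continuous_toLp 2 _).comp (continuous_pi fun i => ?_)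
    fin_cases i <;> simp <;> fun_prop
  have hγc2 : Continuous fun x : E3 => L x 2 := by fun_prop
  have hgraph : frontier U ∩ ball p r ⊆ {x | γ (WithLp.toLp 2 ![L x 0, L x 1]) = L x 2} := by
    rintro x ⟨hxf, hxb⟩
    refine le_antisymm ?_ ?_
    · by_contra hlt
      have hopen : IsOpen ({x : E3 | L x 2 < γ (WithLp.toLp 2 ![L x 0, L x 1])} ∩ ball p r) :=
        (isOpen_lt hγc2 hγc).inter isOpen_ball
      obtain ⟨z, ⟨hz1, hz2⟩, hz3⟩ := mem_closure_iff.1 hxf.1 _ hopen ⟨not_le.1 hlt, hxb⟩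
      exact lt_asymm hz1 ((hloc z hz2).1 hz3)
    · by_contra hlt
      exact (hU.interior_eq ▸ hxf.2) ((hloc x hxb).2 (not_le.1 hlt))
  refine measure_mono_null hgraph ?_
  set v : E3 := L.symm (stdVec 2) with hv
  have hLv : L v = stdVec 2 := by simp [hv]
  refine Measure.addHaar_eq_zero_of_disjoint_translates volume
    (fun n : ℕ => (1 / ((n : ℝ) + 1)) • v) ?_ ?_ (isClosed_eq hγc hγc2).measurableSet
  · refine isBounded_iff_forall_norm_le.2 ⟨‖v‖, ?_⟩
    rintro _ ⟨n, rfl⟩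
    simp only [norm_smul]
    refine mul_le_of_le_one_left (norm_nonneg _) ?_
    rw [Real.norm_of_nonneg (by positivity), div_le_one (by positivity)]
    linarith [(Nat.cast_nonneg n : (0 : ℝ) ≤ n)]
  · intro n m hnm
    refine Set.disjoint_left.2 ?_
    rintro z hz1 hz2
    simp only [singleton_add, mem_image, mem_ofPred_eq] at hz1 hz2
    obtain ⟨x, hx, hxz⟩ := hz1
    obtain ⟨y, hy, hyz⟩ := hz2
    apply hnm
    have e0 : x + (1 / ((n : ℝ) + 1)) • v = y + (1 / ((m : ℝ) + 1)) • v := by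
      rw [add_comm x, add_comm y, hxz, hyz]
    have e1 : L x + (1 / ((n : ℝ) + 1)) • stdVec 2 = L y + (1 / ((m : ℝ) + 1)) • stdVec 2 := by
      simpa only [map_add, map_smul, hLv] using congrArg L e0
    have c0 : L x 0 = L y 0 := by simpa [stdVec] using congrArg (fun z : E3 => z 0) e1
    have c1 : L x 1 = L y 1 := by simpa [stdVec] using congrArg (fun z : E3 => z 1) e1
    have c2 : L x 2 + ((n : ℝ) + 1)⁻¹ = L y 2 + ((m : ℝ) + 1)⁻¹ := by
      simpa [stdVec] using congrArg (fun z : E3 => z 2) e1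
    rw [← hx, ← hy, c0, c1, add_right_inj, inv_inj, add_left_inj, Nat.cast_inj] at c2
    exact c2

/-! ### Transfer from the reference triples to the inclusions. -/

theorem IsModelledOn.isBounded_left {P1 P2 P3 w B B' : Set E3} {c C D : ℝ} (hc : 0 < c)
    (h13 : P1 ⊆ P3) (h : IsModelledOn P1 P2 P3 c C D w B B') (hw : Bornology.IsBounded w) :
    Bornology.IsBounded P1 := by
  obtain ⟨φ, ψ, hφ, hψ, hinv, him, him3, him2, him1, hbl, -⟩ := h
  obtain ⟨R, hR⟩ := isBounded_iff.1 hw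
  refine isBounded_iff.2 ⟨R / c, fun x hx y hy => ?_⟩
  rw [le_div_iff₀' hc]
  exact (hbl x (h13 hx) y (h13 hy)).1.trans
    (hR (him1 ▸ mem_image_of_mem φ hx) (him1 ▸ mem_image_of_mem φ hy))

theorem isOpen_image_of_invOn {P3 B' : Set E3} {φ ψ : E3 → E3}
    (hψ : ContDiffOn ℝ 2 ψ B') (hinv : InvOn ψ φ P3 B') (him : φ '' P3 = B') (hB' : IsOpen B')
    {V : Set E3} (hV : IsOpen V) (hV3 : V ⊆ P3) : IsOpen (φ '' V) := by
  have : φ '' V = B' ∩ ψ ⁻¹' V := by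
    ext z
    constructor
    · rintro ⟨x, hx, rfl⟩
      exact ⟨him ▸ mem_image_of_mem φ (hV3 hx), by
        rw [mem_preimage, hinv.1 (hV3 hx)]; exact hx⟩
    · rintro ⟨hz, hz2⟩
      exact ⟨ψ z, hz2, hinv.2 hz⟩
  rw [this]
  exact hψ.continuousOn.isOpen_inter_preimage hB' hV

/-- The lower Lipschitz bound makes `P1` bounded, so the image of its closure is compact, hence
closed. This puts boundary points of the inclusion under the control of the chart. -/
theorem IsModelledOn.closure_subset {P1 P2 P3 w B B' : Set E3} {c C D : ℝ} (hc : 0 < c)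
    (h12 : closure P1 ⊆ P2) (h23 : closure P2 ⊆ P3)
    (h : IsModelledOn P1 P2 P3 c C D w B B') (hw : Bornology.IsBounded w) :
    ∃ φ ψ : E3 → E3, ContDiffOn ℝ 2 φ P3 ∧ ContDiffOn ℝ 2 ψ B' ∧ InvOn ψ φ P3 B' ∧ φ '' P3 = B' ∧
      φ '' P1 = w ∧ closure w ⊆ φ '' closure P1 := by
  have h13 : closure P1 ⊆ P3 := h12.trans (subset_closure.trans h23)
  have hb := h.isBounded_left hc (subset_closure.trans h13) hw
  obtain ⟨φ, ψ, hφ, hψ, hinv, him, him3, him2, him1, hbl, -⟩ := h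
  refine ⟨φ, ψ, hφ, hψ, hinv, him, him1, ?_⟩
  have hcomp : IsCompact (φ '' closure P1) :=
    hb.isCompact_closure.image_of_continuousOn (hφ.continuousOn.mono h13)
  exact closure_minimal (him1 ▸ image_mono subset_closure) hcomp.isClosed

theorem IsModelledOn.interior_closure {P1 P2 P3 w B B' : Set E3} {c C D : ℝ} (hc : 0 < c)
    (h1 : IsLipschitzDomain P1) (h3 : IsOpen P3)
    (h12 : closure P1 ⊆ P2) (h23 : closure P2 ⊆ P3)
    (h : IsModelledOn P1 P2 P3 c C D w B B') (hw : Bornology.IsBounded w) (hwo : IsOpen w) :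
    interior (closure w) = w := by
  obtain ⟨φ, ψ, hφ, hψ, hinv, him, him1, hcl⟩ := h.closure_subset hc h12 h23 hw
  have h13 : closure P1 ⊆ P3 := h12.trans (subset_closure.trans h23)
  refine Subset.antisymm (fun x hx => ?_) (interior_maximal subset_closure hwo)
  have hopen : IsOpen (P3 ∩ φ ⁻¹' interior (closure w)) :=
    hφ.continuousOn.isOpen_inter_preimage h3 isOpen_interior
  have hsub : P3 ∩ φ ⁻¹' interior (closure w) ⊆ closure P1 := by
    rintro y ⟨hy3, hy⟩
    obtain ⟨z, hz, hzy⟩ := hcl (interior_subset hy)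
    exact (hinv.1.injOn (h13 hz) hy3 hzy) ▸ hz
  obtain ⟨p, hp, rfl⟩ := hcl (interior_subset hx)
  have : p ∈ interior (closure P1) := interior_maximal hsub hopen ⟨h13 hp, hx⟩
  rw [h1.2.2.interior_closure h1.1] at this
  exact him1 ▸ mem_image_of_mem φ this

theorem IsModelledOn.volume_frontier {P1 P2 P3 w B B' : Set E3} {c C D : ℝ} (hc : 0 < c)
    (h1 : IsLipschitzDomain P1)
    (h12 : closure P1 ⊆ P2) (h23 : closure P2 ⊆ P3)
    (h : IsModelledOn P1 P2 P3 c C D w B B') (hw : Bornology.IsBounded w) (hwo : IsOpen w) :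
    volume (frontier w) = 0 := by
  obtain ⟨φ, ψ, hφ, hψ, hinv, him, him1, hcl⟩ := h.closure_subset hc h12 h23 hw
  have h13 : closure P1 ⊆ P3 := h12.trans (subset_closure.trans h23)
  refine measure_mono_null (t := φ '' frontier P1) ?_ ?_
  · intro x hx
    obtain ⟨p, hp, rfl⟩ := hcl hx.1
    refine ⟨p, ⟨hp, fun hp1 => hx.2 ?_⟩, rfl⟩
    rw [hwo.interior_eq, ← him1]
    exact mem_image_of_mem φ (interior_subset hp1)
  · refine addHaar_image_eq_zero_of_differentiableOn_of_addHaar_eq_zero volume ?_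
      (h1.2.2.volume_frontier h1.1)
    exact (hφ.differentiableOn (by norm_num)).mono (frontier_subset_closure.trans h13)

/-- The radius depends only on the reference triple. A ball about `φ p` is connected, and by the
lower Lipschitz bound it meets the image of the closed ball only in the image of the open one; it
cannot leave that image. -/
theorem IsModelledOn.ball_subset {P1 P2 P3 w B B' : Set E3} {c C D δ : ℝ} (hc : 0 < c) (hδ : 0 < δ)
    (hB' : IsOpen B') (h23 : closure P2 ⊆ P3) (hth : thickening δ P1 ⊆ P2)
    (h : IsModelledOn P1 P2 P3 c C D w B B') {x : E3} (hx : x ∈ w) (hwB : w ⊆ B) :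
    ball x (c * (δ / 2)) ⊆ B := by
  obtain ⟨φ, ψ, hφ, hψ, hinv, him, him3, him2, him1, hbl, -⟩ := h
  obtain ⟨p, hp, rfl⟩ := him1 ▸ hx
  have hP23 : P2 ⊆ P3 := subset_closure.trans h23
  have hballP2 : closedBall p (δ / 2) ⊆ P2 := by
    refine Subset.trans ?_ hth
    intro z hz
    exact mem_thickening_iff.2 ⟨p, hp, lt_of_le_of_lt hz (by linarith)⟩
  have hP2B : φ '' P2 ⊆ B := by
    rintro _ ⟨z, hz, rfl⟩
    by_cases hz1 : z ∈ P1
    · exact hwB (him1 ▸ mem_image_of_mem φ hz1)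
    · exact (him2 ▸ mem_image_of_mem φ (⟨hz, hz1⟩ : z ∈ P2 \ P1) : φ z ∈ B \ w).1
  have hop : IsOpen (φ '' ball p (δ / 2)) :=
    isOpen_image_of_invOn hψ hinv him hB' isOpen_ball
      (ball_subset_closedBall.trans (hballP2.trans hP23))
  have hcp : IsCompact (φ '' closedBall p (δ / 2)) :=
    (isCompact_closedBall p _).image_of_continuousOn
      (hφ.continuousOn.mono (hballP2.trans hP23))
  have key : ball (φ p) (c * (δ / 2)) ⊆ φ '' ball p (δ / 2) := by
    refine IsPreconnected.subset_left_of_subset_union hop hcp.isClosed.isOpen_compl ?_ ?_ ?_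
      (convex_ball _ _).isPreconnected
    · exact disjoint_compl_right.mono_left (image_mono ball_subset_closedBall)
    · intro z hz
      by_cases hz2 : z ∈ φ '' closedBall p (δ / 2)
      · left
        obtain ⟨q, hq, rfl⟩ := hz2
        refine ⟨q, ?_, rfl⟩
        have := (hbl q (hP23 (hballP2 hq)) p (hP23 (hballP2 (mem_closedBall_self (by linarith))))).1
        have hz' := lt_of_le_of_lt this hz
        exact lt_of_mul_lt_mul_left hz' hc.le
      · exact Or.inr hz2
    · exact ⟨φ p, mem_ball_self (by positivity), mem_image_of_mem φ (mem_ball_self (by linarith))⟩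
  exact key.trans ((image_mono (ball_subset_closedBall.trans hballP2)).trans hP2B)

/-- The topological properties of a configuration which follow from the geometric conditions:
`inc` enumerates its connected components. -/
structure IsRegularUnion (w : Set E3) (inc : ℕ → Set E3) : Prop where
  union : w = ⋃ k, inc k
  disjoint : Pairwise fun k l => Disjoint (inc k) (inc l)
  inc_open : ∀ k, IsOpen (inc k)
  inc_nonempty : ∀ k, (inc k).Nonempty
  component : ∀ k, ∀ x ∈ inc k, connectedComponentIn w x = inc k
  inc_regular : ∀ k, interior (closure (inc k)) = inc k
  inc_frontier : ∀ k, volume (frontier (inc k)) = 0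
  separated : ∃ δ > 0, ∀ k, ∀ x ∈ inc k, ball x δ ∩ w ⊆ inc k

/-- The separation radius is uniform in the inclusion because there are finitely many reference
triples: a ball of that radius stays in the extension domain, which meets the configuration in one
inclusion only. -/
theorem InclusionSpace.exists_isRegularUnion (X : InclusionSpace) {w : Set E3} (hw : w ∈ X.sets) :
    ∃ inc, IsRegularUnion w inc := by
  obtain ⟨N, P1, P2, P3, c, C, D, hc, hC, hD, hP, hgeo⟩ := X.geometry
  obtain ⟨inc, B, hdec, hmod⟩ := hgeo w hw
  have hsub : ∀ k, inc k ⊆ w := fun k => by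
    conv_rhs => rw [hdec.union]
    exact subset_iUnion inc k
  have hincB : ∀ k, inc k ⊆ B k := fun k => by
    rw [← hdec.inter k]; exact inter_subset_right
  have hbdd : ∀ k, Bornology.IsBounded (inc k) := fun k => (hdec.B_bounded k).subset (hincB k)
  -- The reference domains need not be bounded, but those which model an inclusion are; the value
  -- `1` in the unbounded case is never used.
  have hδ : ∀ j, ∃ δ > 0, Bornology.IsBounded (P1 j) → thickening δ (P1 j) ⊆ P2 j := by
    intro j
    by_cases hb : Bornology.IsBounded (P1 j)
    · obtain ⟨δ, h0, h1⟩ := hb.isCompact_closure.exists_thickening_subset_open (hP j).2.1.1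
        (hP j).2.2.2.1
      exact ⟨δ, h0, fun _ => (thickening_subset_of_subset _ subset_closure).trans h1⟩
    · exact ⟨1, one_pos, fun h => absurd h hb⟩
  choose δ hδ0 hδ1 using hδ
  obtain ⟨η, hη1, hη0⟩ : ∃ η : ℝ, (∀ j, η < δ j) ∧ 0 < η :=
    ((Filter.eventually_all.2 fun j => nhdsWithin_le_nhds (Iio_mem_nhds (hδ0 j))).and
      (self_mem_nhdsWithin : ∀ᶠ x in nhdsWithin (0 : ℝ) (Ioi 0), 0 < x)).exists
  refine ⟨inc, hdec.union, hdec.disjoint, hdec.inc_open, fun k => (hdec.inc_connected k).nonempty,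
    ?_, ?_, ?_, c * (η / 2), by positivity, ?_⟩
  · intro k x hx
    refine Subset.antisymm ?_
      ((hdec.inc_connected k).isPreconnected.subset_connectedComponentIn hx (hsub k))
    refine IsPreconnected.subset_left_of_subset_union (hdec.inc_open k)
      (v := ⋃ l : {l // l ≠ k}, inc l) (isOpen_iUnion fun l => hdec.inc_open l) ?_ ?_
      ⟨x, mem_connectedComponentIn (hsub k hx), hx⟩ isPreconnected_connectedComponentIn
    · exact disjoint_iUnion_right.2 fun l => hdec.disjoint l.2.symm
    · refine (connectedComponentIn_subset w x).trans fun z hz => ?_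
      rw [hdec.union] at hz
      obtain ⟨l, hl⟩ := mem_iUnion.1 hz
      by_cases hlk : l = k
      · exact Or.inl (hlk ▸ hl)
      · exact Or.inr (mem_iUnion.2 ⟨⟨l, hlk⟩, hl⟩)
  · intro k
    obtain ⟨j, B', hB', hBB', hm⟩ := hmod k
    obtain ⟨a1, a2, a3, a4, a5, -⟩ := hP j
    exact hm.interior_closure hc a1 a3.1 a4 a5 (hbdd k) (hdec.inc_open k)
  · intro k
    obtain ⟨j, B', hB', hBB', hm⟩ := hmod k
    obtain ⟨a1, a2, a3, a4, a5, -⟩ := hP j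
    exact hm.volume_frontier hc a1 a4 a5 (hbdd k) (hdec.inc_open k)
  · intro k x hx
    obtain ⟨j, B', hB', hBB', hm⟩ := hmod k
    obtain ⟨a1, a2, a3, a4, a5, -⟩ := hP j
    have hb := hm.isBounded_left hc (subset_closure.trans (a4.trans (subset_closure.trans a5)))
      (hbdd k)
    rw [← hdec.inter k, inter_comm]
    refine inter_subset_inter_right _ (hm.ball_subset hc hη0 hB'.1 a5 ?_ hx (hincB k))
    exact (thickening_mono (hη1 j).le _).trans (hδ1 j hb)

/-! ### From single inclusions to the whole configuration. -/

namespace IsRegularUnion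

variable {w : Set E3} {inc : ℕ → Set E3}

theorem subset (h : IsRegularUnion w inc) (k : ℕ) : inc k ⊆ w := by
  conv_rhs => rw [h.union]
  exact subset_iUnion inc k

theorem exists_mem (h : IsRegularUnion w inc) {x : E3} (hx : x ∈ w) : ∃ k, x ∈ inc k := by
  rw [h.union] at hx
  exact mem_iUnion.1 hx

theorem isOpen (h : IsRegularUnion w inc) : IsOpen w := by
  rw [h.union]; exact isOpen_iUnion h.inc_open

/-- Uniform separation prevents inclusions from accumulating: near a point of the closure only one
of them is visible, so regularity and nullity of the frontier pass from the inclusions to their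
union. -/
theorem exists_mem_closure_inc (h : IsRegularUnion w inc) {x : E3} (hx : x ∈ closure w) :
    ∃ k, ∃ r > 0, x ∈ closure (inc k) ∧ ball x r ∩ w ⊆ inc k := by
  obtain ⟨δ, hδ, hsep⟩ := h.separated
  obtain ⟨z, hzw, hz⟩ := Metric.mem_closure_iff.1 hx (δ / 2) (by linarith)
  obtain ⟨k, hk⟩ := h.exists_mem hzw
  have hsub : ball x (δ / 2) ∩ w ⊆ inc k := by
    refine Subset.trans (inter_subset_inter_left _ ?_) (hsep k z hk)
    exact ball_subset_ball' (by linarith)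
  refine ⟨k, δ / 2, by linarith, ?_, hsub⟩
  have : x ∈ closure (ball x (δ / 2) ∩ w) := by
    rw [mem_closure_iff_nhds] at hx ⊢
    intro t ht
    obtain ⟨y, hy1, hy2⟩ := hx _ (Filter.inter_mem ht (ball_mem_nhds x (half_pos hδ)))
    exact ⟨y, hy1.1, hy1.2, hy2⟩
  exact closure_mono hsub this

theorem interior_closure (h : IsRegularUnion w inc) : interior (closure w) = w := by
  refine Subset.antisymm (fun x hx => ?_) (interior_maximal subset_closure h.isOpen)
  obtain ⟨k, r, hr, hxk, hsub⟩ := h.exists_mem_closure_inc (interior_subset hx)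
  refine h.subset k ?_
  rw [← h.inc_regular k]
  have hopen : IsOpen (interior (closure w) ∩ ball x r) := isOpen_interior.inter isOpen_ball
  refine interior_maximal ?_ hopen ⟨hx, mem_ball_self hr⟩
  rintro z ⟨hz1, hz2⟩
  refine closure_mono hsub ?_
  exact isOpen_ball.inter_closure ⟨hz2, interior_subset hz1⟩

theorem volume_frontier (h : IsRegularUnion w inc) : volume (frontier w) = 0 := by
  refine measure_mono_null (t := ⋃ k, frontier (inc k)) ?_ (measure_iUnion_null h.inc_frontier)
  intro x hx
  obtain ⟨k, r, hr, hxk, hsub⟩ := h.exists_mem_closure_inc hx.1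
  refine mem_iUnion.2 ⟨k, hxk, fun hxi => hx.2 ?_⟩
  rw [h.isOpen.interior_eq]
  exact h.subset k (interior_subset hxi)

/-- Needed for a smooth cutoff which is one on a given inclusion and zero on all the others. -/
theorem closure_inter_closure (h : IsRegularUnion w inc) (k : ℕ) :
    Disjoint (closure (inc k)) (closure (w \ inc k)) := by
  refine Set.disjoint_left.2 fun x hx1 hx2 => ?_
  obtain ⟨l, r, hr, hxl, hsub⟩ := h.exists_mem_closure_inc (closure_mono (h.subset k) hx1)
  obtain ⟨a, ha, hax⟩ := Metric.mem_closure_iff.1 hx1 r hr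
  obtain ⟨b, hb, hbx⟩ := Metric.mem_closure_iff.1 hx2 r hr
  have hal : a ∈ inc l := hsub ⟨by rwa [mem_ball'], h.subset k ha⟩
  have hbl : b ∈ inc l := hsub ⟨by rwa [mem_ball'], hb.1⟩
  have hkl : k = l := by
    by_contra hne
    exact Set.disjoint_left.1 (h.disjoint hne) ha hal
  exact hb.2 (hkl ▸ hbl)

end IsRegularUnion

end

section

variable {X : InclusionSpace}

/-! ### Measurability on the sample space -/

theorem denseRange_ratPoint : DenseRange ratPoint := by
  have h1 : DenseRange fun (q : Fin 3 → ℚ) (i : Fin 3) => ((q i : ℚ) : ℝ) :=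
    DenseRange.piMap fun _ => Rat.denseRange_cast
  exact (WithLp.toLp_surjective 2).denseRange.comp h1 (PiLp.continuous_toLp 2 _)

/-- A countable family of balls which is a basis of the topology. -/
def basisBall (i : (Fin 3 → ℚ) × ℕ) : Set E3 := ball (ratPoint i.1) (1 / ((i.2 : ℝ) + 1))

theorem isOpen_basisBall (i : (Fin 3 → ℚ) × ℕ) : IsOpen (basisBall i) := isOpen_ball

theorem exists_basisBall {U : Set E3} (hU : IsOpen U) {x : E3} (hx : x ∈ U) :
    ∃ i, x ∈ basisBall i ∧ basisBall i ⊆ U := by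
  obtain ⟨r, hr, hrU⟩ := Metric.isOpen_iff.1 hU x hx
  obtain ⟨n, hn⟩ := exists_nat_one_div_lt (half_pos hr)
  obtain ⟨q, hq⟩ := denseRange_ratPoint.exists_dist_lt x
    (Nat.one_div_pos_of_nat : (0 : ℝ) < 1 / ((n : ℝ) + 1))
  exact ⟨(q, n), hq, (ball_subset_ball' (by rw [dist_comm]; linarith)).trans hrU⟩

theorem Config.isOpen (w : X.Config) : IsOpen w.set := by
  obtain ⟨inc, h⟩ := X.exists_isRegularUnion w.2
  exact h.isOpen

theorem Config.interior_closure (w : X.Config) : interior (closure w.set) = w.set := by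
  obtain ⟨inc, h⟩ := X.exists_isRegularUnion w.2
  exact h.interior_closure

theorem Config.interior_closure_originInclusion (w : X.Config) :
    interior (closure (originInclusion w)) = originInclusion w := by
  by_cases h0 : (0 : E3) ∈ w.set
  · obtain ⟨inc, h⟩ := X.exists_isRegularUnion w.2
    obtain ⟨k, hk⟩ := h.exists_mem h0
    have : originInclusion w = inc k := h.component k 0 hk
    rw [this, h.inc_regular k]
  · simp [originInclusion, connectedComponentIn_eq_empty h0]

theorem Config.isOpen_originInclusion (w : X.Config) : IsOpen (originInclusion w) :=
  (Config.isOpen w).connectedComponentIn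

theorem Config.zero_mem_originInclusion {w : X.Config} :
    (0 : E3) ∈ originInclusion w ↔ (0 : E3) ∈ w.set :=
  ⟨fun h => connectedComponentIn_subset _ _ h, fun h => mem_connectedComponentIn h⟩

/-- A configuration is the interior of its closure, so it contains a ball as soon as it contains the
rational points of the ball. -/
theorem measurableSet_basisBall_subset (i : (Fin 3 → ℚ) × ℕ) :
    MeasurableSet {w : X.Config | basisBall i ⊆ w.set} := by
  have : {w : X.Config | basisBall i ⊆ w.set} =
      ⋂ q : {q // ratPoint q ∈ basisBall i}, {w : X.Config | ratPoint q ∈ w.set} := by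
    ext w
    simp only [mem_ofPred_eq, mem_iInter, Subtype.forall]
    refine ⟨fun h q hq => h hq, fun h => ?_⟩
    rw [← Config.interior_closure w]
    refine interior_maximal (fun x hx => ?_) (isOpen_basisBall i)
    refine mem_closure_iff.2 fun V hV hxV => ?_
    obtain ⟨q, hq⟩ := denseRange_ratPoint.exists_mem_open (hV.inter (isOpen_basisBall i))
      ⟨x, hxV, hx⟩
    exact ⟨_, hq.1, h q hq.2⟩
  rw [this]
  exact MeasurableSet.iInter fun q => MeasurableSpace.measurableSet_generateFrom ⟨q, rfl⟩

/-- The event that the ball `i` is the last of `n + 1` successively intersecting basic balls in the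
inclusions, the first of which contains the origin. -/
def chainEvent (X : InclusionSpace) : ℕ → (Fin 3 → ℚ) × ℕ → Set X.Config
  | 0, i => {w | (0 : E3) ∈ basisBall i ∧ basisBall i ⊆ w.set}
  | n + 1, i => ⋃ j : {j // (basisBall i ∩ basisBall j).Nonempty},
      chainEvent X n j ∩ {w | basisBall i ⊆ w.set}

theorem measurableSet_chainEvent (n : ℕ) (i : (Fin 3 → ℚ) × ℕ) :
    MeasurableSet (chainEvent X n i) := by
  induction n generalizing i with
  | zero =>
    by_cases h : (0 : E3) ∈ basisBall i
    · simpa [chainEvent, h] using measurableSet_basisBall_subset i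
    · simp [chainEvent, h]
  | succ n ih =>
    exact MeasurableSet.iUnion fun j => (ih j).inter (measurableSet_basisBall_subset i)

theorem basisBall_subset_originInclusion {n : ℕ} {i : (Fin 3 → ℚ) × ℕ} {w : X.Config}
    (h : w ∈ chainEvent X n i) : basisBall i ⊆ originInclusion w := by
  induction n generalizing i with
  | zero => exact (convex_ball _ _).isPreconnected.subset_connectedComponentIn h.1 h.2
  | succ n ih =>
    obtain ⟨j, hj1, hj2⟩ := mem_iUnion.1 h
    obtain ⟨z, hz1, hz2⟩ := j.2
    have hz := ih hj1 hz2
    have e : originInclusion w = connectedComponentIn w.set z := connectedComponentIn_eq hz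
    rw [e]
    exact (convex_ball _ _).isPreconnected.subset_connectedComponentIn hz1 hj2

/-- The balls reached by chains form an open set, and the balls of the configuration disjoint from
it form another; together they cover the component, so connectedness leaves only the first. The
point is that the right side is a countable union of measurable rectangles in `(w, x)`. -/
theorem mem_originInclusion_iff {w : X.Config} {x : E3} :
    x ∈ originInclusion w ↔ ∃ n i, x ∈ basisBall i ∧ w ∈ chainEvent X n i := by
  refine ⟨fun hx => ?_, fun ⟨n, i, hx, hw⟩ => basisBall_subset_originInclusion hw hx⟩
  have h0 : (0 : E3) ∈ w.set := by
    by_contra h0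
    simp [originInclusion, connectedComponentIn_eq_empty h0] at hx
  set V : Set E3 := ⋃ n, ⋃ i, ⋃ _ : w ∈ chainEvent X n i, basisBall i with hV
  have hVo : IsOpen V :=
    isOpen_iUnion fun n => isOpen_iUnion fun i => isOpen_iUnion fun _ => isOpen_basisBall i
  have memV : ∀ x, x ∈ V ↔ ∃ n i, x ∈ basisBall i ∧ w ∈ chainEvent X n i := by
    intro x; simp [hV, and_comm]
  rw [← memV]
  set U : Set E3 := ⋃ i, ⋃ _ : basisBall i ⊆ w.set ∧ Disjoint V (basisBall i), basisBall i with hU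
  have hUo : IsOpen U := isOpen_iUnion fun i => isOpen_iUnion fun _ => isOpen_basisBall i
  obtain ⟨i0, hi0, hi0w⟩ := exists_basisBall (Config.isOpen w) h0
  refine IsPreconnected.subset_left_of_subset_union hVo hUo ?_ ?_ ?_
    isPreconnected_connectedComponentIn hx
  · simp only [hU, disjoint_iUnion_right]
    exact fun i hi => hi.2
  · intro z hz
    obtain ⟨i, hi, hiw⟩ := exists_basisBall (Config.isOpen w) (connectedComponentIn_subset _ _ hz)
    by_cases hd : Disjoint V (basisBall i)
    · exact Or.inr (mem_iUnion.2 ⟨i, mem_iUnion.2 ⟨⟨hiw, hd⟩, hi⟩⟩)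
    · obtain ⟨a, ha1, ha2⟩ := Set.not_disjoint_iff.1 hd
      obtain ⟨n, j, haj, hj⟩ := (memV a).1 ha1
      exact Or.inl ((memV z).2 ⟨n + 1, i, hi, mem_iUnion.2 ⟨⟨j, a, ha2, haj⟩, hj, hiw⟩⟩)
  · exact ⟨0, mem_connectedComponentIn h0, (memV 0).2 ⟨0, i0, hi0, hi0, hi0w⟩⟩

theorem measurableSet_mem_originInclusion_prod :
    MeasurableSet {p : X.Config × E3 | p.2 ∈ originInclusion p.1} := by
  have : {p : X.Config × E3 | p.2 ∈ originInclusion p.1} =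
      ⋃ n, ⋃ i, chainEvent X n i ×ˢ basisBall i := by
    ext ⟨w, y⟩
    simp [mem_originInclusion_iff, and_comm]
  rw [this]
  exact MeasurableSet.iUnion fun n => MeasurableSet.iUnion fun i =>
    (measurableSet_chainEvent n i).prod (isOpen_basisBall i).measurableSet

theorem measurable_originInclusion : Measurable (originInclusion : X.Config → Set E3) := by
  refine measurable_set_iff.2 fun x => ?_
  exact (measurable_prodMk_right (measurableSet_mem_originInclusion_prod (X := X)) :
    MeasurableSet ((fun w : X.Config => (w, x)) ⁻¹' _)).mem

/-! ### The action of translations -/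

theorem mem_translateSet {y x : E3} {w : Set E3} : x ∈ translateSet y w ↔ x + y ∈ w := by
  simp only [translateSet, mem_image]
  constructor
  · rintro ⟨z, hz, rfl⟩; simpa using hz
  · exact fun h => ⟨x + y, h, by simp⟩

theorem mem_shift {y x : E3} {w : X.Config} : x ∈ (X.shift y w).set ↔ x + y ∈ w.set :=
  mem_translateSet

theorem shift_shift (y z : E3) (w : X.Config) : X.shift y (X.shift z w) = X.shift (y + z) w := by
  refine Subtype.ext (Set.ext fun x => ?_)
  change x ∈ translateSet y (translateSet z w.1) ↔ x ∈ translateSet (y + z) w.1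
  rw [mem_translateSet, mem_translateSet, mem_translateSet, add_assoc]

theorem shift_zero (w : X.Config) : X.shift 0 w = w := by
  refine Subtype.ext (Set.ext fun x => ?_)
  change x ∈ translateSet 0 w.1 ↔ x ∈ w.1
  rw [mem_translateSet, add_zero]

theorem mem_originInclusion_shift {y x : E3} {w : X.Config} :
    x ∈ originInclusion (X.shift y w) ↔ x + y ∈ connectedComponentIn w.set y := by
  by_cases hy : y ∈ w.set
  · have h := (Homeomorph.subRight y).image_connectedComponentIn (x := y) (s := w.set) hy
    have e : (Homeomorph.subRight y : E3 → E3) = fun z => z - y := rfl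
    have : originInclusion (X.shift y w) = translateSet y (connectedComponentIn w.set y) := by
      simp only [e, sub_self] at h
      exact h.symm
    rw [this, mem_translateSet]
  · have h0 : (0 : E3) ∉ (X.shift y w).set := by rwa [mem_shift, zero_add]
    simp [originInclusion, connectedComponentIn_eq_empty hy, connectedComponentIn_eq_empty h0]

/-- This is why conditioning on the shape is compatible with translations by points of the inclusion
itself. -/
theorem originInclusion_shift_of_mem {y : E3} {w : X.Config} (hy : y ∈ originInclusion w) :
    originInclusion (X.shift y w) = {x | x + y ∈ originInclusion w} := by
  ext x
  rw [mem_originInclusion_shift, mem_ofPred_eq, originInclusion, connectedComponentIn_eq hy]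

theorem neg_mem_originInclusion_shift {y : E3} {w : X.Config} :
    -y ∈ originInclusion (X.shift y w) ↔ y ∈ originInclusion w := by
  have key : ∀ (y : E3) (w : X.Config), y ∈ originInclusion w →
      -y ∈ originInclusion (X.shift y w) := by
    intro y w h
    rw [originInclusion_shift_of_mem h, mem_ofPred_eq, neg_add_cancel]
    refine Config.zero_mem_originInclusion.2 ?_
    by_contra h0
    simp [originInclusion, connectedComponentIn_eq_empty h0] at h
  refine ⟨fun h => ?_, key y w⟩
  have := key _ _ h
  rwa [shift_shift, neg_add_cancel, shift_zero, neg_neg] at this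

theorem measurable_shift_prod : Measurable fun p : X.Config × E3 => X.shift p.2 p.1 := by
  refine measurable_generateFrom ?_
  rintro _ ⟨q, rfl⟩
  have : (fun p : X.Config × E3 => X.shift p.2 p.1) ⁻¹' {w | ratPoint q ∈ w.set} =
      ⋃ i, {w | basisBall i ⊆ w.set} ×ˢ ((fun y => ratPoint q + y) ⁻¹' basisBall i) := by
    ext ⟨w, y⟩
    simp only [mem_preimage, mem_ofPred_eq, mem_shift, mem_iUnion, mem_prod]
    constructor
    · intro h
      obtain ⟨i, h1, h2⟩ := exists_basisBall (Config.isOpen w) h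
      exact ⟨i, h2, h1⟩
    · rintro ⟨i, h1, h2⟩
      exact h1 h2
  rw [this]
  exact MeasurableSet.iUnion fun i => (measurableSet_basisBall_subset i).prod
    ((isOpen_basisBall i).preimage (by fun_prop)).measurableSet

theorem measurable_shift (y : E3) : Measurable (X.shift y) :=
  measurable_shift_prod.comp measurable_prodMk_right

/-- The translation of configurations by `y`, as a measurable equivalence. -/
def shiftEquiv (X : InclusionSpace) (y : E3) : X.Config ≃ᵐ X.Config where
  toFun := X.shift y
  invFun := X.shift (-y)
  left_inv w := by rw [shift_shift, neg_add_cancel, shift_zero]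
  right_inv w := by rw [shift_shift, add_neg_cancel, shift_zero]
  measurable_toFun := measurable_shift y
  measurable_invFun := measurable_shift (-y)

variable {P : Measure X.Config}

theorem measurePreserving_shift (hP : IsStationaryLaw P) (y : E3) :
    MeasurePreserving (X.shift y) P P := by
  refine ⟨measurable_shift y, Measure.ext fun s hs => ?_⟩
  rw [Measure.map_apply (measurable_shift y) hs]
  have h := hP (-y) s hs
  rwa [show X.shift (-y) '' s = X.shift y ⁻¹' s from
    ((shiftEquiv X y).symm.toEquiv.image_eq_preimage_symm s)] at h

variable [IsProbabilityMeasure P]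

/-- Stationarity in integrated form. It transfers null sets and integrability between random fields
and their realisations. -/
theorem map_shift_prod (hP : IsStationaryLaw P) (ν : Measure E3) [SFinite ν] :
    (P.prod ν).map (fun p => X.shift p.2 p.1) = ν univ • P := by
  refine Measure.ext fun s hs => ?_
  rw [Measure.map_apply measurable_shift_prod hs,
    Measure.prod_apply_symm (measurable_shift_prod hs)]
  have : ∀ y : E3, P ((fun w => (w, y)) ⁻¹' ((fun p : X.Config × E3 => X.shift p.2 p.1) ⁻¹' s)) =
      P s := fun y => (measurePreserving_shift hP y).measure_preimage hs.nullMeasurableSet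
  simp_rw [this]
  simp [mul_comm]

theorem ae_ae_shift (hP : IsStationaryLaw P) {p : X.Config → Prop} (h : ∀ᵐ w ∂P, p w) :
    ∀ᵐ w ∂P, ∀ᵐ y : E3, p (X.shift y w) := by
  refine Measure.ae_ae_of_ae_prod (p := fun z : X.Config × E3 => p (X.shift z.2 z.1)) ?_
  refine ae_of_ae_map measurable_shift_prod.aemeasurable ?_
  rw [map_shift_prod hP]
  exact Measure.ae_smul_measure h _

theorem ae_of_ae_ae_shift (hP : IsStationaryLaw P) {p : X.Config → Prop}
    (hp : MeasurableSet {w | p w}) (h : ∀ᵐ w ∂P, ∀ᵐ y : E3, p (X.shift y w)) : ∀ᵐ w ∂P, p w := by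
  have h1 : ∀ᵐ z ∂(P.prod (volume : Measure E3)), p (X.shift z.2 z.1) :=
    (Measure.ae_prod_iff_ae_ae (measurable_shift_prod hp)).2 h
  -- The factor is the infinite volume of space; since it is nonzero, the scaled measure has the
  -- null sets of `P`.
  rw [← ae_map_iff measurable_shift_prod.aemeasurable hp, map_shift_prod hP,
    Measure.ae_ennreal_smul_measure_iff] at h1
  · exact h1
  · simp

theorem memLp_shift_prod (hP : IsStationaryLaw P) {p : ENNReal} {F : Type*} [NormedAddCommGroup F]
    {f : X.Config → F} (hf : MemLp f p P) (ν : Measure E3) [IsFiniteMeasure ν] :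
    MemLp (fun z : X.Config × E3 => f (X.shift z.2 z.1)) p (P.prod ν) := by
  have h : MemLp f p ((P.prod ν).map fun p => X.shift p.2 p.1) := by
    rw [map_shift_prod hP]
    exact hf.smul_measure (measure_ne_top ν univ)
  exact h.comp_of_map measurable_shift_prod.aemeasurable

theorem locallyIntegrable_realisation (hP : IsStationaryLaw P) (u : L2 P) :
    ∀ᵐ w ∂P, LocallyIntegrable (fun y : E3 => u (X.shift y w)) := by
  have h : ∀ n : ℕ, ∀ᵐ w ∂P, IntegrableOn (fun y : E3 => u (X.shift y w)) (ball 0 n) := by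
    intro n
    have : IsFiniteMeasure ((volume : Measure E3).restrict (ball 0 n)) :=
      ⟨by simpa using (measure_ball_lt_top : volume (ball (0 : E3) n) < ⊤)⟩
    exact (((memLp_shift_prod hP (Lp.memLp u) ((volume : Measure E3).restrict (ball 0 n))).integrable
      (by norm_num)).prod_right_ae)
  filter_upwards [ae_all_iff.2 h] with w hw x
  obtain ⟨n, hn⟩ := exists_nat_gt ‖x‖
  exact ⟨ball 0 n, isOpen_ball.mem_nhds (by simpa using hn), hw n⟩

theorem ae_realisation_eq_zero (hP : IsStationaryLaw P) {u : L2 P} (hu : u ∈ L2zero P) :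
    ∀ᵐ w ∂P, ∀ᵐ y : E3, y ∉ w.set → u (X.shift y w) = 0 := by
  have hu' : ∀ᵐ w ∂P, (0 : E3) ∉ w.set → u w = 0 := hu
  filter_upwards [ae_ae_shift hP hu'] with w hw
  filter_upwards [hw] with y hy hyw
  exact hy (by rwa [mem_shift, zero_add])

end

section

variable {X : InclusionSpace}

/-! ### The law of the inclusion at the origin and symmetrisation -/

/-- The law of the inclusion containing the origin, on the product σ-algebra. -/
def shapeLaw (P : Measure X.Config) : Measure (Set E3) := P.map originInclusion

theorem measurePreserving_originInclusion (P : Measure X.Config) :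
    MeasurePreserving originInclusion P (shapeLaw P) :=
  measurable_originInclusion.measurePreserving P

instance (P : Measure X.Config) [IsProbabilityMeasure P] : IsProbabilityMeasure (shapeLaw P) :=
  Measure.isProbabilityMeasure_map measurable_originInclusion.aemeasurable

/-- The image of a set under a linear isometry. -/
def isoImage (L : E3 ≃ₗᵢ[ℝ] E3) (K : Set E3) : Set E3 := {x | L.symm x ∈ K}

theorem mem_isoImage {L : E3 ≃ₗᵢ[ℝ] E3} {K : Set E3} {x : E3} :
    x ∈ isoImage L K ↔ L.symm x ∈ K := Iff.rfl

theorem isoImage_isoImage_symm (L : E3 ≃ₗᵢ[ℝ] E3) (K : Set E3) :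
    isoImage L (isoImage L.symm K) = K := by
  ext x; simp [mem_isoImage]

theorem isoImage_symm_isoImage (L : E3 ≃ₗᵢ[ℝ] E3) (K : Set E3) :
    isoImage L.symm (isoImage L K) = K := by
  ext x; simp [mem_isoImage]

theorem measurable_isoImage (L : E3 ≃ₗᵢ[ℝ] E3) : Measurable (isoImage L) :=
  measurable_set_iff.2 fun x => measurable_set_mem (L.symm x)

/-- The law of the inclusion containing the origin is invariant under `L`. -/
def IsShapeInvariant (P : Measure X.Config) (L : E3 ≃ₗᵢ[ℝ] E3) : Prop :=
  MeasurePreserving (isoImage L) (shapeLaw P) (shapeLaw P)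

variable {P : Measure X.Config}

theorem IsShapeInvariant.symm {L : E3 ≃ₗᵢ[ℝ] E3} (h : IsShapeInvariant P L) :
    IsShapeInvariant P L.symm := by
  refine ⟨measurable_isoImage _, ?_⟩
  conv_lhs => rw [← h.map_eq]
  rw [Measure.map_map (measurable_isoImage _) (measurable_isoImage _)]
  have : isoImage L.symm ∘ isoImage L = id := funext fun K => isoImage_symm_isoImage L K
  rw [this, Measure.map_id]

/-- Square-integrable functions of the shape, as functions on the sample space. -/
def shapePullback (P : Measure X.Config) : Lp E3 2 (shapeLaw P) →ₗᵢ[ℝ] L2 P :=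
  Lp.compMeasurePreservingₗᵢ ℝ originInclusion (measurePreserving_originInclusion P)

theorem shapePullback_ae (a : Lp E3 2 (shapeLaw P)) :
    shapePullback P a =ᵐ[P] a ∘ originInclusion :=
  Lp.coeFn_compMeasurePreserving a (measurePreserving_originInclusion P)

/-- The adjoint of `shapePullback`: the conditional expectation with respect to the shape. -/
def shapeProj (P : Measure X.Config) : L2 P →L[ℝ] Lp E3 2 (shapeLaw P) :=
  ContinuousLinearMap.adjoint (shapePullback P).toContinuousLinearMap

theorem inner_shapeProj_left (u : L2 P) (a : Lp E3 2 (shapeLaw P)) :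
    inner ℝ (shapeProj P u) a = inner ℝ u (shapePullback P a) :=
  ContinuousLinearMap.adjoint_inner_left _ _ _

theorem inner_shapeProj_right (u : L2 P) (a : Lp E3 2 (shapeLaw P)) :
    inner ℝ a (shapeProj P u) = inner ℝ (shapePullback P a) u :=
  ContinuousLinearMap.adjoint_inner_right _ _ _

theorem shapeProj_shapePullback (a : Lp E3 2 (shapeLaw P)) :
    shapeProj P (shapePullback P a) = a := by
  refine ext_inner_right ℝ fun b => ?_
  rw [inner_shapeProj_left, LinearIsometry.inner_map_map]

/-- Composition with the action of an isometry which leaves the law of the shape invariant. -/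
def shapeRotate {L : E3 ≃ₗᵢ[ℝ] E3} (h : IsShapeInvariant P L) :
    Lp E3 2 (shapeLaw P) →ₗᵢ[ℝ] Lp E3 2 (shapeLaw P) :=
  Lp.compMeasurePreservingₗᵢ ℝ (isoImage L) h

theorem shapeRotate_ae {L : E3 ≃ₗᵢ[ℝ] E3} (h : IsShapeInvariant P L)
    (a : Lp E3 2 (shapeLaw P)) : shapeRotate h a =ᵐ[shapeLaw P] a ∘ isoImage L :=
  Lp.coeFn_compMeasurePreserving a h

theorem shapeRotate_shapeRotate_symm {L : E3 ≃ₗᵢ[ℝ] E3} (h : IsShapeInvariant P L)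
    (a : Lp E3 2 (shapeLaw P)) : shapeRotate h (shapeRotate h.symm a) = a := by
  refine Lp.ext ?_
  filter_upwards [shapeRotate_ae h (shapeRotate h.symm a),
    h.quasiMeasurePreserving.ae (shapeRotate_ae h.symm a)] with K h1 h2
  rw [h1, Function.comp_apply, h2, Function.comp_apply, isoImage_symm_isoImage]

theorem inner_shapeRotate_left {L : E3 ≃ₗᵢ[ℝ] E3} (h : IsShapeInvariant P L)
    (a b : Lp E3 2 (shapeLaw P)) :
    inner ℝ (shapeRotate h a) b = inner ℝ a (shapeRotate h.symm b) := by
  conv_lhs => rw [← shapeRotate_shapeRotate_symm h b]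
  rw [LinearIsometry.inner_map_map]

/-- Average over all configurations with a given inclusion at the origin, followed by the change of
that inclusion by `L`. -/
def symmetrise {L : E3 ≃ₗᵢ[ℝ] E3} (h : IsShapeInvariant P L) : L2 P →L[ℝ] L2 P :=
  (shapePullback P).toContinuousLinearMap ∘L (shapeRotate h).toContinuousLinearMap ∘L shapeProj P

theorem symmetrise_apply {L : E3 ≃ₗᵢ[ℝ] E3} (h : IsShapeInvariant P L) (u : L2 P) :
    symmetrise h u = shapePullback P (shapeRotate h (shapeProj P u)) := rfl

theorem symmetrise_ae {L : E3 ≃ₗᵢ[ℝ] E3} (h : IsShapeInvariant P L) (u : L2 P) :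
    symmetrise h u =ᵐ[P] (shapeProj P u ∘ isoImage L) ∘ originInclusion := by
  refine (shapePullback_ae _).trans ?_
  exact (measurePreserving_originInclusion P).quasiMeasurePreserving.ae_eq_comp
    (shapeRotate_ae h (shapeProj P u))

theorem inner_symmetrise_left {L : E3 ≃ₗᵢ[ℝ] E3} (h : IsShapeInvariant P L) (u v : L2 P) :
    inner ℝ (symmetrise h u) v = inner ℝ u (symmetrise h.symm v) := by
  rw [symmetrise_apply, ← inner_shapeProj_right, inner_shapeRotate_left, inner_shapeProj_left,
    symmetrise_apply]

/-- The pairing `E[1_{y ∈ ω⁰} g(ω) · u(T_y ω)]`. -/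
def shiftPairing (P : Measure X.Config) (y : E3) (g u : L2 P) : ℝ :=
  ∫ w, {w : X.Config | y ∈ originInclusion w}.indicator
    (fun w => inner ℝ (g w) (u (X.shift y w))) w ∂P

/-- Translation of functions of the shape, inside the shape. -/
def localShift (y : E3) (b : Set E3 → E3) : Set E3 → E3 :=
  {K : Set E3 | (0 : E3) ∈ K ∧ y ∈ K}.indicator fun K => b {x | x + y ∈ K}

theorem measurable_translate_set (y : E3) : Measurable fun K : Set E3 => {x : E3 | x + y ∈ K} :=
  measurable_set_iff.2 fun x => measurable_set_mem (x + y)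

theorem stronglyMeasurable_localShift (y : E3) {b : Set E3 → E3} (hb : StronglyMeasurable b) :
    StronglyMeasurable (localShift y b) :=
  (hb.comp_measurable (measurable_translate_set y)).indicator
    ((measurable_set_mem (0 : E3)).setOf.inter (measurable_set_mem y).setOf)

theorem localShift_originInclusion (y : E3) (b : Set E3 → E3) (w : X.Config) :
    localShift y b (originInclusion w) = {w : X.Config | y ∈ originInclusion w}.indicator
      (fun w => b (originInclusion (X.shift y w))) w := by
  by_cases hy : y ∈ originInclusion w
  · have h0 : (0 : E3) ∈ originInclusion w := by
      by_contra h0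
      rw [Config.zero_mem_originInclusion] at h0
      simp [originInclusion, connectedComponentIn_eq_empty h0] at hy
    simp only [localShift, indicator, mem_ofPred_eq, h0, hy, and_self, if_true,
      originInclusion_shift_of_mem hy]
  · simp only [localShift, indicator, mem_ofPred_eq, hy, and_false, if_false]

theorem measurableSet_mem_originInclusion (y : E3) :
    MeasurableSet {w : X.Config | y ∈ originInclusion w} :=
  ((measurable_set_mem y).comp measurable_originInclusion).setOf

theorem memLp_localShift (hP : IsStationaryLaw P) (y : E3) {b : Set E3 → E3}
    (hb : StronglyMeasurable b) (hb2 : MemLp b 2 (shapeLaw P)) :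
    MemLp (localShift y b) 2 (shapeLaw P) := by
  rw [shapeLaw, memLp_map_measure_iff (stronglyMeasurable_localShift y hb).aestronglyMeasurable
    measurable_originInclusion.aemeasurable]
  have : localShift y b ∘ originInclusion = {w : X.Config | y ∈ originInclusion w}.indicator
      (fun w => b (originInclusion (X.shift y w))) :=
    funext fun w => localShift_originInclusion y b w
  rw [this]
  exact ((hb2.comp_measurePreserving (measurePreserving_originInclusion P)).comp_measurePreserving
    (measurePreserving_shift hP y)).indicator (measurableSet_mem_originInclusion y)

/-- If `u` depends only on the shape, so does `1_{y∈ω⁰} u(T_y ω)`, and `g` may be replaced by its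
conditional expectation. -/
theorem shiftPairing_eq (hP : IsStationaryLaw P) (y : E3) {b : Set E3 → E3}
    (hb : StronglyMeasurable b) (hb2 : MemLp b 2 (shapeLaw P)) (g : L2 P) {u : L2 P}
    (hu : u =ᵐ[P] b ∘ originInclusion) :
    shiftPairing P y g u = ∫ K, inner ℝ (shapeProj P g K) (localShift y b K) ∂(shapeLaw P) := by
  set d := (memLp_localShift hP y hb hb2).toLp with hd
  have hdae : d =ᵐ[shapeLaw P] localShift y b := MemLp.coeFn_toLp _
  have e1 : ∫ K, inner ℝ (shapeProj P g K) (localShift y b K) ∂(shapeLaw P) =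
      inner ℝ (shapeProj P g) d := by
    rw [L2.inner_def]
    refine integral_congr_ae ?_
    filter_upwards [hdae] with K hK
    rw [hK]
  rw [e1, inner_shapeProj_left, L2.inner_def, shiftPairing]
  refine integral_congr_ae ?_
  filter_upwards [shapePullback_ae d,
    (measurePreserving_originInclusion P).quasiMeasurePreserving.ae_eq_comp hdae,
    (measurePreserving_shift hP y).quasiMeasurePreserving.ae_eq_comp hu] with w h1 h2 h3
  rw [h1, h2, Function.comp_apply, localShift_originInclusion]
  simp only [Function.comp_apply] at h3
  by_cases hy : y ∈ originInclusion w
  · simp only [indicator, mem_ofPred_eq, hy, if_true, h3]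
  · simp only [indicator, mem_ofPred_eq, hy, if_false, inner_zero_right]

/-- A mass-transport identity: the origin and `y` lie in one inclusion, and stationarity allows
either to be the base point. -/
theorem shiftPairing_comm (hP : IsStationaryLaw P) (y : E3) (g u : L2 P) :
    shiftPairing P y g u = shiftPairing P (-y) u g := by
  rw [shiftPairing, shiftPairing, ← (measurePreserving_shift hP y).integral_comp
    (shiftEquiv X y).measurableEmbedding ({w : X.Config | -y ∈ originInclusion w}.indicator _)]
  congr 1
  ext w
  have hiff := neg_mem_originInclusion_shift (y := y) (w := w)
  by_cases hy : y ∈ originInclusion w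
  · simp only [indicator, mem_ofPred_eq, hiff, hy, if_true, shift_shift, neg_add_cancel,
      shift_zero, real_inner_comm]
  · simp only [indicator, mem_ofPred_eq, hiff, hy, if_false]

theorem integral_inner_localShift_comm (hP : IsStationaryLaw P) (y : E3) {a b : Set E3 → E3}
    (ha : StronglyMeasurable a) (hb : StronglyMeasurable b) :
    ∫ K, inner ℝ (a K) (localShift y b K) ∂(shapeLaw P) =
      ∫ K, inner ℝ (b K) (localShift (-y) a K) ∂(shapeLaw P) := by
  rw [shapeLaw, integral_map measurable_originInclusion.aemeasurable
      (ha.inner (stronglyMeasurable_localShift y hb)).aestronglyMeasurable,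
    integral_map measurable_originInclusion.aemeasurable
      (hb.inner (stronglyMeasurable_localShift (-y) ha)).aestronglyMeasurable,
    ← (measurePreserving_shift hP y).integral_comp (shiftEquiv X y).measurableEmbedding
      fun w => inner ℝ (b (originInclusion w)) (localShift (-y) a (originInclusion w))]
  congr 1
  ext w
  rw [localShift_originInclusion, localShift_originInclusion]
  have hiff := neg_mem_originInclusion_shift (y := y) (w := w)
  by_cases hy : y ∈ originInclusion w
  · simp only [indicator, mem_ofPred_eq, hiff, hy, if_true, shift_shift, neg_add_cancel,
      shift_zero, real_inner_comm]
  · simp only [indicator, mem_ofPred_eq, hiff, hy, if_false, inner_zero_right]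

theorem localShift_isoImage (L : E3 ≃ₗᵢ[ℝ] E3) (y : E3) (b : Set E3 → E3) (K : Set E3) :
    localShift y (b ∘ isoImage L) K = localShift (L y) b (isoImage L K) := by
  have hset : isoImage L {x | x + y ∈ K} = {x | x + L y ∈ isoImage L K} := by
    ext x; simp [mem_isoImage]
  have h0 : (0 : E3) ∈ isoImage L K ↔ (0 : E3) ∈ K := by simp [mem_isoImage]
  have hy : L y ∈ isoImage L K ↔ y ∈ K := by simp [mem_isoImage]
  simp only [localShift, indicator, mem_ofPred_eq, Function.comp_apply, hset]
  refine @if_congr _ _ _ (_) (_) _ _ _ _ (and_congr h0 hy).symm rfl rfl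

/-- This replaces the rotation of configurations. Each side becomes an integral over the law of the
shape, and the two integrals differ by the measure-preserving substitution `K ↦ L K`. -/
theorem shiftPairing_symmetrise (hP : IsStationaryLaw P) {L : E3 ≃ₗᵢ[ℝ] E3}
    (h : IsShapeInvariant P L) (y : E3) (g u : L2 P) :
    shiftPairing P y g (symmetrise h u) = shiftPairing P (L y) (symmetrise h.symm g) u := by
  have sm : ∀ v : L2 P, StronglyMeasurable (shapeProj P v) := fun v => Lp.stronglyMeasurable _
  have hL := (sm u).comp_measurable (measurable_isoImage L)
  have hL' := (sm g).comp_measurable (measurable_isoImage L.symm)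
  -- On the right the symmetrised field is in the first slot, so the base points are exchanged
  -- before reducing to shapes and exchanged back afterwards.
  rw [shiftPairing_comm hP (L y),
    shiftPairing_eq hP y hL ((Lp.memLp _).comp_measurePreserving h) g (symmetrise_ae h u),
    shiftPairing_eq hP (-(L y)) hL' ((Lp.memLp _).comp_measurePreserving h.symm) u
      (symmetrise_ae h.symm g),
    ← integral_inner_localShift_comm hP (L y) hL' (sm u)]
  let e : Set E3 ≃ᵐ Set E3 :=
    { toFun := isoImage L
      invFun := isoImage L.symm
      left_inv := isoImage_symm_isoImage L
      right_inv := isoImage_isoImage_symm L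
      measurable_toFun := measurable_isoImage L
      measurable_invFun := measurable_isoImage L.symm }
  rw [← MeasurePreserving.integral_comp h e.measurableEmbedding fun K =>
    inner ℝ ((shapeProj P g ∘ isoImage L.symm) K) (localShift (L y) (shapeProj P u) K)]
  congr 1
  ext K
  rw [localShift_isoImage, Function.comp_apply, isoImage_symm_isoImage]

/-- Conditioning preserves vanishing off the inclusions: the part `d` of the projection on shapes
missing the origin satisfies `⟨d, d⟩ = ⟨u, d ∘ ω⁰⟩ = 0`. Rotation preserves it because `L` fixes the
origin. -/
theorem symmetrise_mem_L2zero {L : E3 ≃ₗᵢ[ℝ] E3} (h : IsShapeInvariant P L) {u : L2 P}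
    (hu : u ∈ L2zero P) : symmetrise h u ∈ L2zero P := by
  have hu' : ∀ᵐ w ∂P, (0 : E3) ∉ w.set → u w = 0 := hu
  have hN : MeasurableSet {K : Set E3 | (0 : E3) ∉ K} := (measurable_set_mem (0 : E3)).setOf.compl
  have hdm : MemLp ({K : Set E3 | (0 : E3) ∉ K}.indicator (shapeProj P u)) 2 (shapeLaw P) :=
    (Lp.memLp (shapeProj P u)).indicator hN
  set d := hdm.toLp with hd
  have hdae : d =ᵐ[shapeLaw P] {K : Set E3 | (0 : E3) ∉ K}.indicator (shapeProj P u) :=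
    MemLp.coeFn_toLp _
  have e1 : (inner ℝ d d : ℝ) = inner ℝ (shapeProj P u) d := by
    rw [L2.inner_def, L2.inner_def]
    refine integral_congr_ae ?_
    filter_upwards [hdae] with K hK
    rw [hK]
    by_cases h0 : (0 : E3) ∉ K
    · simp only [indicator, mem_ofPred_eq, h0, not_false_eq_true, if_true]
    · simp only [indicator, mem_ofPred_eq, h0, if_false, inner_zero_right]
  have e2 : (inner ℝ (shapeProj P u) d : ℝ) = 0 := by
    rw [inner_shapeProj_left, L2.inner_def]
    refine integral_eq_zero_of_ae ?_
    filter_upwards [hu', shapePullback_ae d,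
      (measurePreserving_originInclusion P).quasiMeasurePreserving.ae_eq_comp hdae] with w h1 h2 h3
    by_cases h0 : (0 : E3) ∈ w.set
    · rw [h2, h3, Function.comp_apply, indicator_of_notMem, inner_zero_right]
      · rfl
      · exact fun hn => hn (Config.zero_mem_originInclusion.2 h0)
    · rw [h1 h0, inner_zero_left]
      rfl
  have hd0 : d = 0 := inner_self_eq_zero.1 (e1.trans e2)
  have hz : ∀ᵐ K ∂(shapeLaw P), (0 : E3) ∉ K → shapeProj P u K = 0 := by
    filter_upwards [hdae, (hd0 ▸ Lp.coeFn_zero E3 2 (shapeLaw P) : d =ᵐ[shapeLaw P] 0)]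
      with K h1 h2 h0
    rw [h2] at h1
    simpa only [indicator, mem_ofPred_eq, h0, not_false_eq_true, if_true, Pi.zero_apply]
      using h1.symm
  change ∀ᵐ w ∂P, (0 : E3) ∉ w.set → symmetrise h u w = 0
  filter_upwards [symmetrise_ae h u,
    (measurePreserving_originInclusion P).quasiMeasurePreserving.ae
      (h.quasiMeasurePreserving.ae hz)] with w h1 h2 h0
  rw [h1]
  refine h2 fun hm => h0 ?_
  rw [mem_isoImage, map_zero] at hm
  exact Config.zero_mem_originInclusion.1 hm

/-! ### Linear maps acting on values -/

/-- The action of a linear map on the values of a random field. -/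
def valueMap {α : Type*} [MeasurableSpace α] (μ : Measure α) (A : E3 →L[ℝ] E3) :
    Lp E3 2 μ →L[ℝ] Lp E3 2 μ := A.compLpL 2 μ

theorem valueMap_ae {α : Type*} [MeasurableSpace α] {μ : Measure α} (A : E3 →L[ℝ] E3)
    (u : Lp E3 2 μ) : ∀ᵐ w ∂μ, valueMap μ A u w = A (u w) :=
  A.coeFn_compLpL u

theorem inner_valueMap_left {α : Type*} [MeasurableSpace α] {μ : Measure α} (A : E3 →L[ℝ] E3)
    (u v : Lp E3 2 μ) :
    inner ℝ (valueMap μ A u) v = inner ℝ u (valueMap μ (ContinuousLinearMap.adjoint A) v) := by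
  rw [L2.inner_def, L2.inner_def]
  refine integral_congr_ae ?_
  filter_upwards [valueMap_ae A u, valueMap_ae (ContinuousLinearMap.adjoint A) v] with w h1 h2
  rw [h1, h2, ContinuousLinearMap.adjoint_inner_right]

theorem valueMap_shapePullback (A : E3 →L[ℝ] E3) (a : Lp E3 2 (shapeLaw P)) :
    valueMap P A (shapePullback P a) = shapePullback P (valueMap _ A a) := by
  refine Lp.ext ?_
  filter_upwards [valueMap_ae A (shapePullback P a), shapePullback_ae a,
    shapePullback_ae (valueMap _ A a),
    (measurePreserving_originInclusion P).quasiMeasurePreserving.ae (valueMap_ae A a)]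
    with w h1 h2 h3 h4
  rw [h1, h2, h3, Function.comp_apply, Function.comp_apply, h4]

theorem valueMap_shapeRotate {L : E3 ≃ₗᵢ[ℝ] E3} (h : IsShapeInvariant P L) (A : E3 →L[ℝ] E3)
    (a : Lp E3 2 (shapeLaw P)) :
    valueMap _ A (shapeRotate h a) = shapeRotate h (valueMap _ A a) := by
  refine Lp.ext ?_
  filter_upwards [valueMap_ae A (shapeRotate h a), shapeRotate_ae h a,
    shapeRotate_ae h (valueMap _ A a), h.quasiMeasurePreserving.ae (valueMap_ae A a)]
    with w h1 h2 h3 h4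
  rw [h1, h2, h3, Function.comp_apply, Function.comp_apply, h4]

theorem valueMap_shapeProj (A : E3 →L[ℝ] E3) (u : L2 P) :
    valueMap _ A (shapeProj P u) = shapeProj P (valueMap P A u) := by
  refine ext_inner_right ℝ fun b => ?_
  rw [inner_valueMap_left, inner_shapeProj_left, inner_shapeProj_left, inner_valueMap_left,
    valueMap_shapePullback]

theorem valueMap_symmetrise {L : E3 ≃ₗᵢ[ℝ] E3} (h : IsShapeInvariant P L) (A : E3 →L[ℝ] E3)
    (u : L2 P) : valueMap P A (symmetrise h u) = symmetrise h (valueMap P A u) := by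
  rw [symmetrise_apply, symmetrise_apply, valueMap_shapePullback, valueMap_shapeRotate,
    valueMap_shapeProj]

theorem shiftPairing_valueMap (hP : IsStationaryLaw P) (A : E3 →L[ℝ] E3) (y : E3) (g u : L2 P) :
    shiftPairing P y g (valueMap P A u) =
      shiftPairing P y (valueMap P (ContinuousLinearMap.adjoint A) g) u := by
  refine integral_congr_ae ?_
  filter_upwards [valueMap_ae (ContinuousLinearMap.adjoint A) g,
    (measurePreserving_shift hP y).quasiMeasurePreserving.ae (valueMap_ae A u)] with w h1 h2
  simp only [indicator]
  rw [h1, h2, ContinuousLinearMap.adjoint_inner_left]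

theorem valueMap_mem_L2zero (A : E3 →L[ℝ] E3) {u : L2 P} (hu : u ∈ L2zero P) :
    valueMap P A u ∈ L2zero P := by
  have hu' : ∀ᵐ w ∂P, (0 : E3) ∉ w.set → u w = 0 := hu
  change ∀ᵐ w ∂P, (0 : E3) ∉ w.set → valueMap P A u w = 0
  filter_upwards [hu', valueMap_ae A u] with w h1 h2 h0
  rw [h2, h1 h0, map_zero]

variable [IsProbabilityMeasure P]

/-- The random field which is equal to the constant `c` in the inclusions. -/
def constInclusion (P : Measure X.Config) [IsProbabilityMeasure P] (c : E3) : L2 P :=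
  indicatorConstLp 2 (measurableSet_zero_mem (X := X)) (measure_ne_top P _) c

theorem constInclusion_ae (c : E3) : constInclusion P c =ᵐ[P]
    {w : X.Config | (0 : E3) ∈ w.set}.indicator fun _ => c :=
  indicatorConstLp_coeFn

theorem inner_constInclusion {v : L2 P} (hv : v ∈ L2zero P) (c : E3) :
    inner ℝ (constInclusion P c) v = ∫ w, inner ℝ c (v w) ∂P := by
  have hv' : ∀ᵐ w ∂P, (0 : E3) ∉ w.set → v w = 0 := hv
  rw [L2.inner_def]
  refine integral_congr_ae ?_
  filter_upwards [hv', constInclusion_ae c] with w h1 h2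
  by_cases h0 : (0 : E3) ∈ w.set
  · simp only [h2, indicator, mem_ofPred_eq, h0, if_true]
  · rw [h1 h0, inner_zero_right, inner_zero_right]

theorem valueMap_constInclusion (A : E3 →L[ℝ] E3) (c : E3) :
    valueMap P A (constInclusion P c) = constInclusion P (A c) := by
  refine Lp.ext ?_
  filter_upwards [valueMap_ae A (constInclusion P c), constInclusion_ae (P := P) c,
    constInclusion_ae (P := P) (A c)] with w h1 h2 h3
  rw [h1, h2, h3]
  by_cases h0 : (0 : E3) ∈ w.set
  · simp only [indicator, mem_ofPred_eq, h0, if_true]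
  · simp only [indicator, mem_ofPred_eq, h0, if_false, map_zero]

theorem symmetrise_constInclusion {L : E3 ≃ₗᵢ[ℝ] E3} (h : IsShapeInvariant P L) (c : E3) :
    symmetrise h (constInclusion P c) = constInclusion P c := by
  have hm : MeasurableSet {K : Set E3 | (0 : E3) ∈ K} := (measurable_set_mem (0 : E3)).setOf
  set d : Lp E3 2 (shapeLaw P) := indicatorConstLp 2 hm (measure_ne_top _ _) c
  have hd : d =ᵐ[shapeLaw P] {K : Set E3 | (0 : E3) ∈ K}.indicator fun _ => c :=
    indicatorConstLp_coeFn
  have e1 : shapePullback P d = constInclusion P c := by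
    refine Lp.ext ?_
    filter_upwards [shapePullback_ae d, constInclusion_ae (P := P) c,
      (measurePreserving_originInclusion P).quasiMeasurePreserving.ae_eq_comp hd] with w h1 h2 h3
    rw [h1, h2, h3]
    have hiff := Config.zero_mem_originInclusion (w := w)
    simp only [Function.comp_apply, indicator, mem_ofPred_eq]
    classical exact if_congr hiff rfl rfl
  have e2 : shapeRotate h d = d := by
    refine Lp.ext ?_
    filter_upwards [shapeRotate_ae h d, hd, h.quasiMeasurePreserving.ae_eq_comp hd] with K h1 h2 h3
    rw [h1, h2, h3]
    have hiff : (0 : E3) ∈ isoImage L K ↔ (0 : E3) ∈ K := by rw [mem_isoImage, map_zero]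
    simp only [Function.comp_apply, indicator, mem_ofPred_eq]
    classical exact if_congr hiff rfl rfl
  rw [symmetrise_apply, ← e1, shapeProj_shapePullback, e2]

end

section

variable {X : InclusionSpace} {P : Measure X.Config}

/-! ### Statistical symmetries -/

/-- The distance from a point to `K` is continuous in `K`, so containing that point in the closure
is a closed condition. An uncountable intersection of such conditions is still closed, and the radii
of balls about `x` are countable. -/
theorem measurableSet_mem_interior_closure (x : E3) :
    MeasurableSet[hausdorffBorel] {K : Set E3 | x ∈ interior (closure K)} := by
  let _ : PseudoEMetricSpace (Set E3) := PseudoEMetricSpace.hausdorff (α := E3)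
  let _ : MeasurableSpace (Set E3) := hausdorffBorel
  have : BorelSpace (Set E3) := ⟨rfl⟩
  have hcont : ∀ y : E3, Continuous fun K : Set E3 => infEDist y K := by
    intro y
    refine continuous_of_le_add_edist 1 (by simp) fun K K' => ?_
    rw [one_mul, edist_comm]
    exact infEDist_le_infEDist_add_hausdorffEDist
  have : {K : Set E3 | x ∈ interior (closure K)} =
      ⋃ n : ℕ, ⋂ y : E3, ⋂ _ : y ∈ ball x (1 / ((n : ℝ) + 1)), {K : Set E3 | infEDist y K = 0} := by
    ext K
    simp only [mem_ofPred_eq, mem_iUnion, mem_iInter, ← mem_closure_iff_infEDist_zero]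
    rw [mem_interior_iff_mem_nhds, Metric.nhds_basis_ball_inv_nat_succ.mem_iff]
    simp [subset_def]
  rw [this]
  refine MeasurableSet.iUnion fun n => IsClosed.measurableSet ?_
  exact isClosed_iInter fun y => isClosed_iInter fun _ => isClosed_eq (hcont y) continuous_const

theorem isoImage_interior_closure (L : E3 ≃ₗᵢ[ℝ] E3) (K : Set E3) :
    interior (closure (isoImage L K)) = isoImage L (interior (closure K)) := by
  change interior (closure (L.symm.toHomeomorph ⁻¹' K)) =
    L.symm.toHomeomorph ⁻¹' (interior (closure K))
  rw [← Homeomorph.preimage_closure, ← Homeomorph.preimage_interior]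

/-- The map `K ↦ interior (closure K)` is measurable from the Hausdorff to the product σ-algebra,
fixes every inclusion and commutes with isometries. The hypothesis is applied to preimages under
this map. -/
theorem HasMicroSymmetry.isShapeInvariant {M : Matrix (Fin 3) (Fin 3) ℝ} (h : HasMicroSymmetry P M)
    {L : E3 ≃ₗᵢ[ℝ] E3} (hL : ∀ x, matAct M x = L x) : IsShapeInvariant P L := by
  -- An inclusion lies in the image of a family under `L` exactly when its image under `L⁻¹` lies in
  -- the family, so the invariance appears first for the inverse.
  have hsymm : IsShapeInvariant P L.symm := by
    refine ⟨measurable_isoImage _, Measure.ext fun A hA => ?_⟩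
    rw [Measure.map_apply (measurable_isoImage _) hA, shapeLaw,
      Measure.map_apply measurable_originInclusion hA,
      Measure.map_apply measurable_originInclusion (measurable_isoImage _ hA)]
    have hmeas : @Measurable _ _ hausdorffBorel _ fun K : Set E3 => interior (closure K) :=
      (@measurable_set_iff _ _ hausdorffBorel _).2 fun x =>
        @MeasurableSet.mem _ _ hausdorffBorel (measurableSet_mem_interior_closure x)
    have key := h _ (hmeas hA)
    have e1 : {w : X.Config | originInclusion w ∈
        (fun K : Set E3 => interior (closure K)) ⁻¹' A} = originInclusion ⁻¹' A := by
      ext w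
      simp only [mem_ofPred_eq, mem_preimage, Config.interior_closure_originInclusion]
    have himg : (fun K : Set E3 => matAct M '' K) = isoImage L := by
      funext K
      ext x
      rw [mem_isoImage]
      constructor
      · rintro ⟨z, hz, rfl⟩
        rwa [hL, L.symm_apply_apply]
      · exact fun hx => ⟨_, hx, by rw [hL, L.apply_symm_apply]⟩
    have e2 : {w : X.Config | originInclusion w ∈ (fun K : Set E3 => matAct M '' K) ''
        ((fun K : Set E3 => interior (closure K)) ⁻¹' A)} =
        originInclusion ⁻¹' (isoImage L.symm ⁻¹' A) := by
      rw [himg]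
      ext w
      simp only [mem_ofPred_eq, mem_preimage, mem_image]
      have hreg : interior (closure (isoImage L.symm (originInclusion w))) =
          isoImage L.symm (originInclusion w) := by
        rw [isoImage_interior_closure, Config.interior_closure_originInclusion]
      constructor
      · rintro ⟨K, hK, hKw⟩
        rw [← hKw, isoImage_symm_isoImage] at hreg ⊢
        rwa [hreg] at hK
      · exact fun hw => ⟨_, hreg.symm ▸ hw, isoImage_isoImage_symm _ _⟩
    rw [e1, e2] at key
    exact key.symm
  exact hsymm.symm

end

section

variable {X : InclusionSpace} {P : Measure X.Config}

/-! ### Gradients inside one inclusion -/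

/-- The realisations of `U` are the weak derivatives of the realisation of `u` in the inclusion
containing the origin, for test functions which need not vanish on its boundary. -/
def IsLocalGradAt (w : X.Config) (u : L2 P) (U : Fin 3 → L2 P) : Prop :=
  ∀ φ : E3 → ℝ, ContDiff ℝ ∞ φ → HasCompactSupport φ → ∀ m : Fin 3,
    ∫ y in originInclusion w, (fderiv ℝ φ y (stdVec m)) • u (X.shift y w) =
      - ∫ y in originInclusion w, φ y • U m (X.shift y w)

/-- The property of `IsLocalGradAt` tested against random fields. -/
def IsWeakLocalGrad (P : Measure X.Config) (u : L2 P) (U : Fin 3 → L2 P) : Prop :=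
  ∀ φ : E3 → ℝ, ContDiff ℝ ∞ φ → HasCompactSupport φ → ∀ (m : Fin 3) (g : L2 P),
    ∫ y, fderiv ℝ φ y (stdVec m) * shiftPairing P y g u =
      - ∫ y, φ y * shiftPairing P y g (U m)

theorem continuous_fderiv_stdVec {φ : E3 → ℝ} (hφ : ContDiff ℝ ∞ φ) (v : E3) :
    Continuous fun y => fderiv ℝ φ y v :=
  (hφ.continuous_fderiv (by simp)).clm_apply continuous_const

theorem hasCompactSupport_fderiv_apply {φ : E3 → ℝ} (hc : HasCompactSupport φ) (v : E3) :
    HasCompactSupport fun y => fderiv ℝ φ y v :=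
  hc.fderiv_apply ℝ v

theorem indicator_prod_eq {F : Type*} [Zero F] (f : X.Config × E3 → F) (w : X.Config) (y : E3) :
    {z : X.Config × E3 | z.2 ∈ originInclusion z.1}.indicator f (w, y) =
      (originInclusion w).indicator (fun y => f (w, y)) y := by
  classical
  simp only [indicator_apply, mem_ofPred_eq]

theorem integral_smul_indicator (φ : E3 → ℝ) (u : L2 P) (w : X.Config) :
    ∫ y, φ y • {z : X.Config × E3 | z.2 ∈ originInclusion z.1}.indicator
      (fun z => u (X.shift z.2 z.1)) (w, y) =
    ∫ y in originInclusion w, φ y • u (X.shift y w) := by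
  rw [← integral_indicator (Config.isOpen_originInclusion w).measurableSet]
  congr 1
  ext1 y
  rw [indicator_prod_eq, indicator_smul_apply]

variable [IsProbabilityMeasure P]

/-- The derivative vanishes on the open complement of the closure of the inclusions, and their
frontier is null. -/
theorem HasGrad.mem_L2zero (hP : IsStationaryLaw P) {u : L2 P} {U : Fin 3 → L2 P}
    (h : HasGrad P u U) (hu : u ∈ L2zero P) (m : Fin 3) : U m ∈ L2zero P := by
  have hmeas : MeasurableSet {w : X.Config | (0 : E3) ∉ w.set → U m w = 0} := by
    have e : {w : X.Config | (0 : E3) ∉ w.set → U m w = 0} =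
        {w : X.Config | (0 : E3) ∈ w.set} ∪ {w | U m w = 0} := by
      ext w; simp only [mem_ofPred_eq, mem_union]; tauto
    rw [e]
    exact measurableSet_zero_mem.union
      ((Lp.stronglyMeasurable (U m)).measurableSet_eq_fun stronglyMeasurable_const)
  refine ae_of_ae_ae_shift hP hmeas ?_
  filter_upwards [h, ae_realisation_eq_zero hP hu, locallyIntegrable_realisation hP (U m)]
    with w hw hw0 hwi
  have hext : ∀ᵐ y : E3, y ∈ (closure w.set)ᶜ → U m (X.shift y w) = 0 := by
    refine isClosed_closure.isOpen_compl.ae_eq_zero_of_integral_contDiff_smul_eq_zero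
      (hwi.locallyIntegrableOn _) fun φ hφ hc hsupp => ?_
    have hz : ∫ y : E3, (fderiv ℝ φ y (stdVec m)) • u (X.shift y w) = 0 := by
      refine integral_eq_zero_of_ae ?_
      filter_upwards [hw0] with y hy
      by_cases hyw : y ∈ w.set
      · have hy0 : y ∉ tsupport (fderiv ℝ φ) := fun hy1 =>
          hsupp (tsupport_fderiv_subset ℝ hy1) (subset_closure hyw)
        simp [image_eq_zero_of_notMem_tsupport hy0]
      · simp [hy hyw]
    have := hw φ hφ hc m
    rw [hz] at this
    exact neg_eq_zero.1 this.symm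
  obtain ⟨inc, hinc⟩ := X.exists_isRegularUnion w.2
  have hfr : ∀ᵐ y : E3, y ∉ frontier w.set := measure_eq_zero_iff_ae_notMem.1 hinc.volume_frontier
  filter_upwards [hext, hfr] with y hy1 hy2 hy3
  rw [mem_shift, zero_add] at hy3
  refine hy1 fun hyc => hy2 ⟨hyc, ?_⟩
  rwa [(Config.isOpen w).interior_eq]

/-- The global identity is tested with `φ χ`, where `χ` is one on the inclusion at the origin and
zero on the others. Outside the inclusions both fields vanish, so no boundary term appears. -/
theorem HasGrad.ae_isLocalGradAt (hP : IsStationaryLaw P) {u : L2 P} {U : Fin 3 → L2 P}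
    (h : HasGrad P u U) (hu : u ∈ L2zero P) : ∀ᵐ w ∂P, IsLocalGradAt w u U := by
  filter_upwards [h, ae_realisation_eq_zero hP hu,
    ae_all_iff.2 fun m => ae_realisation_eq_zero hP (h.mem_L2zero hP hu m)] with w hw hu0 hU0
  intro φ hφ hc m
  by_cases h0 : (0 : E3) ∈ w.set
  swap
  · simp [originInclusion, connectedComponentIn_eq_empty h0]
  obtain ⟨inc, hinc⟩ := X.exists_isRegularUnion w.2
  obtain ⟨k, hk⟩ := hinc.exists_mem h0
  have horig : originInclusion w = inc k := hinc.component k 0 hk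
  obtain ⟨χ, hχ0, hχ1, -⟩ := exists_contMDiffMap_zero_one_of_isClosed (n := ⊤)
    (modelWithCornersSelf ℝ E3) isClosed_closure isClosed_closure
    (hinc.closure_inter_closure k).symm
  have hχ : ContDiff ℝ ∞ χ := χ.contMDiff.contDiff
  have near1 : ∀ y ∈ inc k, (fun z => φ z * χ z) =ᶠ[nhds y] φ := fun y hy => by
    filter_upwards [(hinc.inc_open k).mem_nhds hy] with z hz
    rw [hχ1 (subset_closure hz), Pi.one_apply, mul_one]
  have near0 : ∀ y ∈ w.set, y ∉ inc k → (fun z => φ z * χ z) =ᶠ[nhds y] fun _ => 0 :=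
    fun y hy hyk => by
    obtain ⟨l, hl⟩ := hinc.exists_mem hy
    have hlk : l ≠ k := fun e => hyk (e ▸ hl)
    filter_upwards [(hinc.inc_open l).mem_nhds hl] with z hz
    rw [hχ0 (subset_closure ⟨hinc.subset l hz, Set.disjoint_left.1 (hinc.disjoint hlk) hz⟩),
      Pi.zero_apply, mul_zero]
  have key := hw (fun z => φ z * χ z) (hφ.mul hχ) hc.mul_right m
  have e1 : ∫ y : E3, (fderiv ℝ (fun z => φ z * χ z) y (stdVec m)) • u (X.shift y w) =
      ∫ y in originInclusion w, (fderiv ℝ φ y (stdVec m)) • u (X.shift y w) := by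
    rw [← integral_indicator (Config.isOpen_originInclusion w).measurableSet]
    refine integral_congr_ae ?_
    filter_upwards [hu0] with y hy
    by_cases hyk : y ∈ inc k
    · rw [indicator_of_mem (horig ▸ hyk), (near1 y hyk).fderiv_eq]
    · rw [indicator_of_notMem (horig ▸ hyk)]
      by_cases hyw : y ∈ w.set
      · rw [(near0 y hyw hyk).fderiv_eq]
        simp
      · rw [hy hyw, smul_zero]
  have e2 : ∫ y : E3, (φ y * χ y) • U m (X.shift y w) =
      ∫ y in originInclusion w, φ y • U m (X.shift y w) := by
    rw [← integral_indicator (Config.isOpen_originInclusion w).measurableSet]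
    refine integral_congr_ae ?_
    filter_upwards [hU0 m] with y hy
    by_cases hyk : y ∈ inc k
    · rw [indicator_of_mem (horig ▸ hyk), show φ y * χ y = φ y from (near1 y hyk).self_of_nhds]
    · rw [indicator_of_notMem (horig ▸ hyk)]
      by_cases hyw : y ∈ w.set
      · rw [show φ y * χ y = 0 from (near0 y hyw hyk).self_of_nhds, zero_smul]
      · rw [hy hyw, smul_zero]
  rw [← e1, ← e2]
  exact key

/-! ### Integration in both variables -/

theorem integrable_smul_realisation {φ : E3 → ℝ} (hφ : Continuous φ)
    (hc : HasCompactSupport φ) {F : Type*} [NormedAddCommGroup F] [NormedSpace ℝ F]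
    {f : X.Config × E3 → F}
    (hf : ∀ R : ℝ, Integrable f (P.prod ((volume : Measure E3).restrict (closedBall 0 R)))) :
    Integrable (fun z : X.Config × E3 => φ z.2 • {z : X.Config × E3 |
      z.2 ∈ originInclusion z.1}.indicator f z) (P.prod volume) := by
  obtain ⟨R, hR⟩ := hc.isCompact.isBounded.subset_closedBall (0 : E3)
  obtain ⟨B, hB⟩ := hφ.bounded_above_of_compact_support hc
  have h1 := (hf R).indicator (measurableSet_mem_originInclusion_prod (X := X))
  have h2 : Integrable (fun z : X.Config × E3 => φ z.2 • {z : X.Config × E3 |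
      z.2 ∈ originInclusion z.1}.indicator f z)
      (P.prod ((volume : Measure E3).restrict (closedBall 0 R))) :=
    h1.bdd_smul B (hφ.comp_stronglyMeasurable measurable_snd.stronglyMeasurable).aestronglyMeasurable
      (Filter.Eventually.of_forall fun z => hB z.2)
  have e : P.prod ((volume : Measure E3).restrict (closedBall 0 R)) =
      (P.prod volume).restrict (univ ×ˢ closedBall 0 R) := by
    rw [← Measure.prod_restrict, Measure.restrict_univ]
  rw [e] at h2
  refine (integrableOn_iff_integrable_of_support_subset ?_).1 h2
  intro z hz
  refine ⟨mem_univ _, hR (subset_tsupport _ ?_)⟩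
  intro h0
  exact hz (by simp [h0])

instance isFiniteMeasure_restrict_closedBall (R : ℝ) :
    IsFiniteMeasure ((volume : Measure E3).restrict (closedBall 0 R)) :=
  ⟨by simpa using (measure_closedBall_lt_top : volume (closedBall (0 : E3) R) < ⊤)⟩

theorem integrable_prod_inner (hP : IsStationaryLaw P) {φ : E3 → ℝ} (hφ : Continuous φ)
    (hc : HasCompactSupport φ) (g u : L2 P) :
    Integrable (fun z : X.Config × E3 => φ z.2 • {z : X.Config × E3 |
      z.2 ∈ originInclusion z.1}.indicator
        (fun z => (inner ℝ (g z.1) (u (X.shift z.2 z.1)) : ℝ)) z) (P.prod volume) := by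
  refine integrable_smul_realisation hφ hc fun R => ?_
  have h1 : MemLp (fun z : X.Config × E3 => g z.1) 2
      (P.prod ((volume : Measure E3).restrict (closedBall 0 R))) :=
    (Lp.memLp g).comp_fst _
  have h2 := memLp_shift_prod hP (Lp.memLp u) ((volume : Measure E3).restrict (closedBall 0 R))
  refine Integrable.mono' (h1.norm.integrable_mul h2.norm)
    (h1.aestronglyMeasurable.inner h2.aestronglyMeasurable) ?_
  exact Filter.Eventually.of_forall fun z => norm_inner_le_norm _ _

theorem integrable_prod_realisation (hP : IsStationaryLaw P) {φ : E3 → ℝ} (hφ : Continuous φ)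
    (hc : HasCompactSupport φ) (u : L2 P) :
    Integrable (fun z : X.Config × E3 => φ z.2 • {z : X.Config × E3 |
      z.2 ∈ originInclusion z.1}.indicator (fun z => u (X.shift z.2 z.1)) z) (P.prod volume) :=
  integrable_smul_realisation hφ hc fun _ =>
    (memLp_shift_prod hP (Lp.memLp u) _).integrable (by norm_num)

theorem integrable_setIntegral_realisation (hP : IsStationaryLaw P) {φ : E3 → ℝ}
    (hφ : Continuous φ) (hc : HasCompactSupport φ) (u : L2 P) :
    Integrable (fun w => ∫ y in originInclusion w, φ y • u (X.shift y w)) P := by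
  have := (integrable_prod_realisation hP hφ hc u).integral_prod_left
  simpa only [integral_smul_indicator] using this

theorem integrable_mul_shiftPairing (hP : IsStationaryLaw P) {φ : E3 → ℝ} (hφ : Continuous φ)
    (hc : HasCompactSupport φ) (g u : L2 P) :
    Integrable fun y => φ y * shiftPairing P y g u := by
  have := (integrable_prod_inner hP hφ hc g u).integral_prod_right
  simp only [smul_eq_mul, integral_const_mul] at this
  exact this

theorem integral_inner_setIntegral (hP : IsStationaryLaw P) {φ : E3 → ℝ} (hφ : Continuous φ)
    (hc : HasCompactSupport φ) (g u : L2 P) :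
    ∫ w, inner ℝ (g w) (∫ y in originInclusion w, φ y • u (X.shift y w)) ∂P =
      ∫ y, φ y * shiftPairing P y g u := by
  have hint := integrable_prod_inner hP hφ hc g u
  have h1 := integral_prod _ hint
  have h2 := integral_prod_symm _ hint
  have e2 : ∀ y : E3, ∫ w, φ (w, y).2 • {z : X.Config × E3 | z.2 ∈ originInclusion z.1}.indicator
        (fun z => (inner ℝ (g z.1) (u (X.shift z.2 z.1)) : ℝ)) (w, y) ∂P =
      φ y * shiftPairing P y g u := fun y => by
    rw [shiftPairing, ← integral_const_mul]
    rfl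
  simp only [e2] at h2
  rw [← h2, h1]
  refine integral_congr_ae ?_
  filter_upwards [(integrable_prod_realisation hP hφ hc u).prod_right_ae] with w hw
  rw [← integral_smul_indicator, ← integral_inner hw]
  congr 1
  ext1 y
  simp only [indicator_prod_eq, inner_smul_right, smul_eq_mul]
  by_cases hy : y ∈ originInclusion w
  · rw [indicator_of_mem hy, indicator_of_mem hy]
  · rw [indicator_of_notMem hy, indicator_of_notMem hy, inner_zero_right]

theorem HasGrad.isWeakLocalGrad (hP : IsStationaryLaw P) {u : L2 P} {U : Fin 3 → L2 P}
    (h : HasGrad P u U) (hu : u ∈ L2zero P) : IsWeakLocalGrad P u U := by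
  intro φ hφ hc m g
  rw [← integral_inner_setIntegral hP (continuous_fderiv_stdVec hφ _)
      (hasCompactSupport_fderiv_apply hc _), ← integral_inner_setIntegral hP hφ.continuous hc,
    ← integral_neg]
  refine integral_congr_ae ?_
  filter_upwards [h.ae_isLocalGradAt hP hu] with w hw
  rw [hw φ hφ hc m, inner_neg_right]

/-- Testing with `g = 1_A c` for all events `A` and vectors `c` identifies the random vectors. The
exceptional null set depends on `φ`. -/
theorem IsWeakLocalGrad.ae_eq (hP : IsStationaryLaw P) {u : L2 P} {U : Fin 3 → L2 P}
    (h : IsWeakLocalGrad P u U) {φ : E3 → ℝ} (hφ : ContDiff ℝ ∞ φ) (hc : HasCompactSupport φ)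
    (m : Fin 3) : ∀ᵐ w ∂P, ∫ y in originInclusion w, (fderiv ℝ φ y (stdVec m)) • u (X.shift y w) =
      - ∫ y in originInclusion w, φ y • U m (X.shift y w) := by
  have i1 := integrable_setIntegral_realisation hP (continuous_fderiv_stdVec hφ (stdVec m))
    (hasCompactSupport_fderiv_apply hc (stdVec m)) u
  have i2 := integrable_setIntegral_realisation hP hφ.continuous hc (U m)
  have hz := (i1.add i2).ae_eq_zero_of_forall_setIntegral_eq_zero fun A hA _ => by
    refine ext_inner_left ℝ fun c => ?_
    rw [inner_zero_right, ← integral_inner (i1.add i2).integrableOn]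
    set g : L2 P := indicatorConstLp 2 hA (measure_ne_top P _) c
    have hg : g =ᵐ[P] A.indicator fun _ => c := indicatorConstLp_coeFn
    have key := h φ hφ hc m g
    rw [← integral_inner_setIntegral hP (continuous_fderiv_stdVec hφ _)
      (hasCompactSupport_fderiv_apply hc _), ← integral_inner_setIntegral hP hφ.continuous hc]
      at key
    have conv : ∀ J : X.Config → E3,
        ∫ w, inner ℝ (g w) (J w) ∂P = ∫ w in A, inner ℝ c (J w) ∂P := by
      intro J
      rw [← integral_indicator hA]
      refine integral_congr_ae ?_
      filter_upwards [hg] with w hw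
      rw [hw]
      by_cases hwA : w ∈ A
      · rw [indicator_of_mem hwA, indicator_of_mem hwA]
      · rw [indicator_of_notMem hwA, indicator_of_notMem hwA, inner_zero_left]
    rw [conv, conv] at key
    simp only [Pi.add_apply, inner_add_right]
    rw [integral_add (i1.integrableOn.const_inner c) (i2.integrableOn.const_inner c), key,
      neg_add_cancel]
  filter_upwards [hz] with w hw
  exact eq_neg_of_add_eq_zero_left hw

end

section

variable {X : InclusionSpace} {P : Measure X.Config}

/-! ### From weak local gradients to gradients -/

/-- Smooth functions supported in a closed ball. -/
def testFunctions (R : ℕ) : Set (E3 → ℝ) :=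
  {φ | ContDiff ℝ ∞ φ ∧ tsupport φ ⊆ closedBall 0 R}

/-- The values and partial derivatives of a test function on a closed ball. -/
def testJet (R : ℕ) (φ : testFunctions R) : C(closedBall (0 : E3) R, ℝ × (Fin 3 → ℝ)) where
  toFun y := (φ.1 y, fun m => fderiv ℝ φ.1 y (stdVec m))
  continuous_toFun := by
    refine (φ.2.1.continuous.comp continuous_subtype_val).prodMk (continuous_pi fun m => ?_)
    exact (continuous_fderiv_stdVec φ.2.1 _).comp continuous_subtype_val

theorem eq_zero_of_notMem_closedBall {R : ℕ} {φ : E3 → ℝ} (hφ : φ ∈ testFunctions R) {y : E3}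
    (hy : y ∉ closedBall (0 : E3) R) : φ y = 0 ∧ fderiv ℝ φ y = 0 :=
  ⟨image_eq_zero_of_notMem_tsupport fun h => hy (hφ.2 h),
    image_eq_zero_of_notMem_tsupport fun h => hy (hφ.2 (tsupport_fderiv_subset ℝ h))⟩

/-- The jets of test functions form a subset of a separable space of continuous functions on a
compact ball. Values and first derivatives are all that the local gradient identity involves. -/
theorem exists_countable_dense_testFunctions (R : ℕ) :
    ∃ D : Set (E3 → ℝ), D.Countable ∧ D ⊆ testFunctions R ∧ ∀ φ ∈ testFunctions R, ∀ ε > 0,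
      ∃ ψ ∈ D, ∀ y ∈ closedBall (0 : E3) R, |φ y - ψ y| ≤ ε ∧
        ∀ m, |fderiv ℝ φ y (stdVec m) - fderiv ℝ ψ y (stdVec m)| ≤ ε := by
  have : CompactSpace (closedBall (0 : E3) R) :=
    isCompact_iff_compactSpace.1 (isCompact_closedBall 0 _)
  obtain ⟨S, hSc, hSd⟩ := TopologicalSpace.exists_countable_dense (range (testJet R))
  choose f hf using fun s : range (testJet R) => s.2
  refine ⟨(fun s => (f s).1) '' S, hSc.image _, ?_, fun φ hφ ε hε => ?_⟩
  · rintro _ ⟨s, -, rfl⟩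
    exact (f s).2
  · obtain ⟨s, hs, hd⟩ := hSd.exists_dist_lt ⟨testJet R ⟨φ, hφ⟩, mem_range_self _⟩ hε
    refine ⟨_, mem_image_of_mem _ hs, fun y hy => ?_⟩
    have hd' : dist (testJet R ⟨φ, hφ⟩ ⟨y, hy⟩) (testJet R (f s) ⟨y, hy⟩) ≤ ε := by
      refine (ContinuousMap.dist_apply_le_dist _).trans ?_
      rw [hf s]
      exact hd.le
    rw [Prod.dist_eq, max_le_iff] at hd'
    refine ⟨hd'.1, fun m => ?_⟩
    exact (dist_le_pi_dist _ _ m).trans hd'.2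

/-- The defect `J` of the identity is linear in `φ` and bounded by the C¹ distance times the
integral `A` of the fields over a ball. -/
theorem isLocalGradAt_of_dense {w : X.Config} {u : L2 P} {U : Fin 3 → L2 P}
    {D : ℕ → Set (E3 → ℝ)} (hD : ∀ R, D R ⊆ testFunctions R)
    (hdense : ∀ R, ∀ φ ∈ testFunctions R, ∀ ε > 0,
      ∃ ψ ∈ D R, ∀ y ∈ closedBall (0 : E3) R, |φ y - ψ y| ≤ ε ∧
        ∀ m, |fderiv ℝ φ y (stdVec m) - fderiv ℝ ψ y (stdVec m)| ≤ ε)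
    (hu : LocallyIntegrable fun y : E3 => u (X.shift y w))
    (hU : ∀ m, LocallyIntegrable fun y : E3 => U m (X.shift y w))
    (h : ∀ R, ∀ ψ ∈ D R, ∀ m,
      ∫ y in originInclusion w, (fderiv ℝ ψ y (stdVec m)) • u (X.shift y w) =
        - ∫ y in originInclusion w, ψ y • U m (X.shift y w)) : IsLocalGradAt w u U := by
  intro φ hφ hc m
  obtain ⟨r, hr⟩ := hc.isCompact.isBounded.subset_closedBall (0 : E3)
  obtain ⟨R, hR⟩ := exists_nat_ge r
  have hφR : φ ∈ testFunctions R := ⟨hφ, hr.trans (closedBall_subset_closedBall hR)⟩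
  have compact : ∀ ψ ∈ testFunctions R, HasCompactSupport ψ := fun ψ hψ =>
    HasCompactSupport.of_support_subset_isCompact (isCompact_closedBall (0 : E3) R)
      ((subset_tsupport _).trans hψ.2)
  have int1 : ∀ ψ ∈ testFunctions R,
      Integrable fun y => (fderiv ℝ ψ y (stdVec m)) • u (X.shift y w) := fun ψ hψ =>
    hu.integrable_smul_left_of_hasCompactSupport (continuous_fderiv_stdVec hψ.1 _)
      (hasCompactSupport_fderiv_apply (compact ψ hψ) _)
  have int2 : ∀ ψ ∈ testFunctions R, Integrable fun y => ψ y • U m (X.shift y w) := fun ψ hψ =>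
    (hU m).integrable_smul_left_of_hasCompactSupport hψ.1.continuous (compact ψ hψ)
  set J : (E3 → ℝ) → E3 := fun ψ =>
    (∫ y in originInclusion w, (fderiv ℝ ψ y (stdVec m)) • u (X.shift y w)) +
      ∫ y in originInclusion w, ψ y • U m (X.shift y w) with hJ
  have hball : IntegrableOn (fun y : E3 => ‖u (X.shift y w)‖ + ‖U m (X.shift y w)‖)
      (closedBall (0 : E3) R) :=
    ((hu.integrableOn_isCompact (isCompact_closedBall 0 _)).norm).add
      (((hU m).integrableOn_isCompact (isCompact_closedBall 0 _)).norm)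
  set A : ℝ := ∫ y in closedBall (0 : E3) R, (‖u (X.shift y w)‖ + ‖U m (X.shift y w)‖) with hA
  have bound : ∀ ε > 0, ‖J φ‖ ≤ ε * A := by
    intro ε hε
    obtain ⟨ψ, hψD, hψ⟩ := hdense R φ hφR ε hε
    have hψR := hD R hψD
    have hJψ : J ψ = 0 := by
      simp only [hJ]
      rw [h R ψ hψD m, neg_add_cancel]
    have hsub : J φ = ∫ y in originInclusion w,
        ((fderiv ℝ φ y (stdVec m) - fderiv ℝ ψ y (stdVec m)) • u (X.shift y w) +
          (φ y - ψ y) • U m (X.shift y w)) := by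
      rw [← sub_zero (J φ), ← hJψ]
      simp only [hJ, sub_smul]
      have hadd := integral_add (μ := volume.restrict (originInclusion w))
        ((int1 φ hφR).sub (int1 ψ hψR)).integrableOn ((int2 φ hφR).sub (int2 ψ hψR)).integrableOn
      simp only [Pi.sub_apply] at hadd
      rw [hadd, integral_sub (int1 φ hφR).integrableOn (int1 ψ hψR).integrableOn,
        integral_sub (int2 φ hφR).integrableOn (int2 ψ hψR).integrableOn]
      abel
    have hind : Integrable ((closedBall (0 : E3) R).indicator fun y =>
        ε * (‖u (X.shift y w)‖ + ‖U m (X.shift y w)‖)) :=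
      IntegrableOn.integrable_indicator (hball.const_mul ε) isClosed_closedBall.measurableSet
    rw [hsub, hA, ← integral_const_mul, ← integral_indicator isClosed_closedBall.measurableSet]
    refine (norm_integral_le_of_norm_le (g := (closedBall (0 : E3) R).indicator fun y =>
      ε * (‖u (X.shift y w)‖ + ‖U m (X.shift y w)‖)) ?_ ?_).trans ?_
    · exact hind.integrableOn
    · refine Filter.Eventually.of_forall fun y => ?_
      by_cases hy : y ∈ closedBall (0 : E3) R
      · rw [indicator_of_mem hy, mul_add]
        refine (norm_add_le _ _).trans (add_le_add ?_ ?_)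
        · rw [norm_smul]
          exact mul_le_mul_of_nonneg_right ((hψ y hy).2 m) (norm_nonneg _)
        · rw [norm_smul]
          exact mul_le_mul_of_nonneg_right (hψ y hy).1 (norm_nonneg _)
      · have e1 := eq_zero_of_notMem_closedBall hφR hy
        have e2 := eq_zero_of_notMem_closedBall hψR hy
        rw [indicator_of_notMem hy, e1.1, e1.2, e2.1, e2.2]
        simp
    · refine setIntegral_le_integral hind (Filter.Eventually.of_forall fun y => ?_)
      exact indicator_nonneg (fun y _ => by positivity) y
  have hA0 : 0 ≤ A := integral_nonneg fun y => by positivity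
  have hJ0 : J φ = 0 := by
    rw [← norm_le_zero_iff]
    refine le_of_forall_pos_le_add fun δ hδ => ?_
    rw [zero_add]
    refine (bound (δ / (A + 1)) (by positivity)).trans ?_
    rw [div_mul_eq_mul_div, div_le_iff₀ (by positivity)]
    nlinarith
  exact eq_neg_of_add_eq_zero_left hJ0

theorem setIntegral_component_eq {w : X.Config} {y₀ : E3} {u : L2 P} {U : Fin 3 → L2 P}
    (h : IsLocalGradAt (X.shift y₀ w) u U) {φ : E3 → ℝ} (hφ : ContDiff ℝ ∞ φ)
    (hc : HasCompactSupport φ) (m : Fin 3) :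
    ∫ y in connectedComponentIn w.set y₀, (fderiv ℝ φ y (stdVec m)) • u (X.shift y w) =
      - ∫ y in connectedComponentIn w.set y₀, φ y • U m (X.shift y w) := by
  have hmeas : MeasurableSet (connectedComponentIn w.set y₀) :=
    ((Config.isOpen w).connectedComponentIn).measurableSet
  have conv : ∀ (f : E3 → ℝ) (v : L2 P),
      ∫ y in originInclusion (X.shift y₀ w), f (y + y₀) • v (X.shift y (X.shift y₀ w)) =
        ∫ y in connectedComponentIn w.set y₀, f y • v (X.shift y w) := by
    intro f v
    rw [← integral_indicator hmeas,
      ← integral_indicator (Config.isOpen_originInclusion _).measurableSet,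
      ← integral_add_right_eq_self ((connectedComponentIn w.set y₀).indicator _) y₀]
    congr 1
    ext1 y
    have hiff := mem_originInclusion_shift (y := y₀) (x := y) (w := w)
    by_cases hy : y + y₀ ∈ connectedComponentIn w.set y₀
    · rw [indicator_of_mem hy, indicator_of_mem (hiff.2 hy), shift_shift]
    · rw [indicator_of_notMem hy, indicator_of_notMem fun hn => hy (hiff.1 hn)]
  have key := h (fun y => φ (y + y₀)) (hφ.comp (contDiff_id.add contDiff_const))
    (hc.comp_homeomorph (Homeomorph.addRight y₀)) m
  simp only [fderiv_comp_add_right] at key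
  rw [conv (fun y => fderiv ℝ φ y (stdVec m)) u, conv φ (U m)] at key
  exact key

/-- By stationarity the local identity holds at `T_y ω` for almost every `y`. Each inclusion has
positive volume, so it contains such a `y`; summing over the inclusions gives the integral over
space. -/
theorem hasGrad_of_ae_isLocalGradAt [IsProbabilityMeasure P] (hP : IsStationaryLaw P) {u : L2 P}
    {U : Fin 3 → L2 P} (hu : u ∈ L2zero P) (hU : ∀ m, U m ∈ L2zero P)
    (h : ∀ᵐ w ∂P, IsLocalGradAt w u U) : HasGrad P u U := by
  filter_upwards [ae_ae_shift hP h, ae_realisation_eq_zero hP hu,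
    ae_all_iff.2 fun m => ae_realisation_eq_zero hP (hU m), locallyIntegrable_realisation hP u,
    ae_all_iff.2 fun m => locallyIntegrable_realisation hP (U m)] with w hw hu0 hU0 hui hUi
  intro φ hφ hc m
  obtain ⟨inc, hinc⟩ := X.exists_isRegularUnion w.2
  have hk : ∀ k, ∫ y in inc k, (fderiv ℝ φ y (stdVec m)) • u (X.shift y w) =
      - ∫ y in inc k, φ y • U m (X.shift y w) := by
    intro k
    have hpos : volume (inc k) ≠ 0 := ((hinc.inc_open k).measure_pos _ (hinc.inc_nonempty k)).ne'
    obtain ⟨y₀, hy₀, hy₀k⟩ : ∃ y₀, IsLocalGradAt (X.shift y₀ w) u U ∧ y₀ ∈ inc k := by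
      by_contra! hn
      exact hpos (measure_mono_null (fun y hy hg => hn y hg hy) hw)
    rw [← hinc.component k y₀ hy₀k]
    exact setIntegral_component_eq hy₀ hφ hc m
  have conv : ∀ (f : E3 → ℝ) (v : L2 P), (∀ᵐ y : E3, y ∉ w.set → v (X.shift y w) = 0) →
      Integrable (fun y => f y • v (X.shift y w)) →
      HasSum (fun k => ∫ y in inc k, f y • v (X.shift y w)) (∫ y, f y • v (X.shift y w)) := by
    intro f v hv0 hfv
    have := hasSum_integral_iUnion (fun k => (hinc.inc_open k).measurableSet) hinc.disjoint
      hfv.integrableOn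
    rw [← hinc.union] at this
    rwa [setIntegral_eq_integral_of_ae_compl_eq_zero] at this
    filter_upwards [hv0] with y hy hyw
    rw [hy hyw, smul_zero]
  have s1 := conv (fun y => fderiv ℝ φ y (stdVec m)) u hu0
    (hui.integrable_smul_left_of_hasCompactSupport (continuous_fderiv_stdVec hφ _)
      (hasCompactSupport_fderiv_apply hc _))
  have s2 := (conv φ (U m) (hU0 m)
    ((hUi m).integrable_smul_left_of_hasCompactSupport hφ.continuous hc)).neg
  simp only [hk] at s1
  exact s1.unique s2

theorem IsWeakLocalGrad.hasGrad [IsProbabilityMeasure P] (hP : IsStationaryLaw P) {u : L2 P}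
    {U : Fin 3 → L2 P} (hu : u ∈ L2zero P) (hU : ∀ m, U m ∈ L2zero P)
    (h : IsWeakLocalGrad P u U) : HasGrad P u U := by
  refine hasGrad_of_ae_isLocalGradAt hP hu hU ?_
  choose D hDc hD hdense using exists_countable_dense_testFunctions
  have hall : ∀ᵐ w ∂P, ∀ R, ∀ ψ ∈ D R, ∀ m,
      ∫ y in originInclusion w, (fderiv ℝ ψ y (stdVec m)) • u (X.shift y w) =
        - ∫ y in originInclusion w, ψ y • U m (X.shift y w) := by
    refine ae_all_iff.2 fun R => (ae_ball_iff (hDc R)).2 fun ψ hψ => ae_all_iff.2 fun m => ?_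
    exact h.ae_eq hP (hD R hψ).1 (HasCompactSupport.of_support_subset_isCompact
      (isCompact_closedBall (0 : E3) R) ((subset_tsupport _).trans (hD R hψ).2)) m
  filter_upwards [hall, locallyIntegrable_realisation hP u,
    ae_all_iff.2 fun m => locallyIntegrable_realisation hP (U m)] with w hw hui hUi
  exact isLocalGradAt_of_dense hD hdense hui hUi hw

/-! ### Symmetrisation of gradients -/

theorem shiftPairing_smul (hP : IsStationaryLaw P) (y : E3) (g u : L2 P) (c : ℝ) :
    shiftPairing P y g (c • u) = c * shiftPairing P y g u := by
  rw [shiftPairing, shiftPairing, ← integral_const_mul]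
  refine integral_congr_ae ?_
  filter_upwards [(measurePreserving_shift hP y).quasiMeasurePreserving.ae (Lp.coeFn_smul c u)]
    with w hw
  simp only [indicator]
  rw [hw, Pi.smul_apply, inner_smul_right, mul_ite, mul_zero]

theorem shiftPairing_add (hP : IsStationaryLaw P) (y : E3) (g u v : L2 P) :
    shiftPairing P y g (u + v) = shiftPairing P y g u + shiftPairing P y g v := by
  have hint : ∀ u : L2 P, Integrable ({w : X.Config | y ∈ originInclusion w}.indicator
      fun w => (inner ℝ (g w) (u (X.shift y w)) : ℝ)) P := by
    intro u
    refine Integrable.indicator ?_ (measurableSet_mem_originInclusion y)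
    have h1 := Lp.memLp g
    have h2 := (Lp.memLp u).comp_measurePreserving (measurePreserving_shift hP y)
    exact Integrable.mono' (h1.norm.integrable_mul h2.norm)
      (h1.aestronglyMeasurable.inner h2.aestronglyMeasurable)
      (Filter.Eventually.of_forall fun w => norm_inner_le_norm _ _)
  rw [shiftPairing, shiftPairing, shiftPairing, ← integral_add (hint u) (hint v)]
  refine integral_congr_ae ?_
  filter_upwards [(measurePreserving_shift hP y).quasiMeasurePreserving.ae (Lp.coeFn_add u v)]
    with w hw
  simp only [indicator]
  rw [hw, Pi.add_apply, inner_add_right]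
  split_ifs <;> simp

theorem shiftPairing_sum (hP : IsStationaryLaw P) (y : E3) (g : L2 P) (c : Fin 3 → ℝ)
    (U : Fin 3 → L2 P) :
    shiftPairing P y g (∑ p, c p • U p) = ∑ p, c p * shiftPairing P y g (U p) := by
  simp only [Fin.sum_univ_three, shiftPairing_add hP, shiftPairing_smul hP]

theorem stdVec_expansion (v : E3) : v = ∑ p, v p • stdVec p := by
  ext i
  simp [stdVec, Fin.sum_univ_three]
  fin_cases i <;> simp

/-- The chain rule in weak form: in the pairings the symmetrisation becomes the substitution `z = L
y`, with test function `φ ∘ L⁻¹`. -/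
theorem IsWeakLocalGrad.symmetrise [IsProbabilityMeasure P] (hP : IsStationaryLaw P)
    {L : E3 ≃ₗᵢ[ℝ] E3} (hL : IsShapeInvariant P L) {u : L2 P} {U : Fin 3 → L2 P}
    (h : IsWeakLocalGrad P u U) :
    IsWeakLocalGrad P (symmetrise hL u) fun m => ∑ p, L (stdVec m) p • symmetrise hL (U p) := by
  intro φ hφ hc m g
  set ψ : E3 → ℝ := fun z => φ (L.symm z) with hψ
  have hψs : ContDiff ℝ ∞ ψ := hφ.comp L.symm.contDiff
  have hψc : HasCompactSupport ψ := hc.comp_homeomorph L.symm.toHomeomorph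
  have hder : ∀ y, fderiv ℝ φ y (stdVec m) =
      ∑ p, L (stdVec m) p * fderiv ℝ ψ (L y) (stdVec p) := by
    intro y
    have e1 : fderiv ℝ ψ (L y) (L (stdVec m)) = fderiv ℝ φ y (stdVec m) := by
      have hcomp : HasFDerivAt ψ ((fderiv ℝ φ (L.symm (L y))).comp
          (L.symm.toContinuousLinearEquiv : E3 →L[ℝ] E3)) (L y) :=
        HasFDerivAt.comp (L y) (hφ.differentiable (by simp) _).hasFDerivAt
          L.symm.toContinuousLinearEquiv.hasFDerivAt
      rw [hcomp.fderiv]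
      simp
    rw [← e1]
    conv_lhs => rw [stdVec_expansion (L (stdVec m))]
    simp only [map_sum, map_smul, smul_eq_mul]
  have change_var : ∀ f : E3 → ℝ, ∫ y, f (L y) = ∫ z, f z := fun f =>
    L.measurePreserving.integral_comp L.toHomeomorph.measurableEmbedding f
  set g' := RandomElasticity.symmetrise hL.symm g
  have e1 : ∫ y, fderiv ℝ φ y (stdVec m) * shiftPairing P y g (RandomElasticity.symmetrise hL u) =
      ∑ p, L (stdVec m) p * ∫ z, fderiv ℝ ψ z (stdVec p) * shiftPairing P z g' u := by
    rw [← integral_congr_ae (Filter.Eventually.of_forall fun y => ?_),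
      change_var fun z => ∑ p, L (stdVec m) p * (fderiv ℝ ψ z (stdVec p) * shiftPairing P z g' u),
      integral_finsetSum _ fun p _ => ?_]
    · simp only [integral_const_mul]
    · exact (integrable_mul_shiftPairing hP (continuous_fderiv_stdVec hψs _)
        (hasCompactSupport_fderiv_apply hψc _) g' u).const_mul _
    · simp only
      rw [shiftPairing_symmetrise hP, hder, Finset.sum_mul]
      simp only [mul_assoc]
      rfl
  have e2 : ∫ y, φ y * shiftPairing P y g (∑ p, L (stdVec m) p •
      RandomElasticity.symmetrise hL (U p)) =
      ∑ p, L (stdVec m) p * ∫ z, ψ z * shiftPairing P z g' (U p) := by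
    rw [← integral_congr_ae (Filter.Eventually.of_forall fun y => ?_),
      change_var fun z => ∑ p, L (stdVec m) p * (ψ z * shiftPairing P z g' (U p)),
      integral_finsetSum _ fun p _ => ?_]
    · simp only [integral_const_mul]
    · exact (integrable_mul_shiftPairing hP hψs.continuous hψc g' (U p)).const_mul _
    · simp only
      rw [shiftPairing_sum hP, Finset.mul_sum]
      refine Finset.sum_congr rfl fun p _ => ?_
      rw [shiftPairing_symmetrise hP, hψ]
      simp only [L.symm_apply_apply]
      ring
  rw [e1, e2, ← Finset.sum_neg_distrib]
  refine Finset.sum_congr rfl fun p _ => ?_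
  rw [h ψ hψs hψc p g', mul_neg]

theorem IsWeakLocalGrad.valueMap (hP : IsStationaryLaw P) (A : E3 →L[ℝ] E3) {u : L2 P}
    {U : Fin 3 → L2 P} (h : IsWeakLocalGrad P u U) :
    IsWeakLocalGrad P (valueMap P A u) fun m => valueMap P A (U m) := by
  intro φ hφ hc m g
  simp only [shiftPairing_valueMap hP]
  exact h φ hφ hc m _

end

section

variable {X : InclusionSpace} {P : Measure X.Config}

/-! ### Invariance of the form -/

/-- The linear map `x ↦ C_{abmn} x_n` for fixed `a` and `m`. -/
def tensorRow (C : Tensor4) (a m : Fin 3) : E3 →L[ℝ] E3 :=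
  LinearMap.toContinuousLinearMap
    { toFun := fun x => WithLp.toLp 2 fun b => ∑ n, C a b m n * x n
      map_add' := fun x y => by
        ext b
        simp [mul_add, Finset.sum_add_distrib]
      map_smul' := fun c x => by
        ext b
        simp only [PiLp.smul_apply, smul_eq_mul, RingHom.id_apply, Finset.mul_sum]
        exact Finset.sum_congr rfl fun n _ => by ring }

theorem tensorRow_apply (C : Tensor4) (a m b : Fin 3) (x : E3) :
    tensorRow C a m x b = ∑ n, C a b m n * x n := rfl

/-- Written this way, the form can be treated with the adjoints of `symmetrise` and `valueMap`. -/
theorem form_eq_sum_inner (C : Tensor4) (G V : Fin 3 → L2 P) :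
    form P C G V = ∑ a, ∑ m, inner ℝ (valueMap P (tensorRow C a m) (G m)) (V a) := by
  simp only [L2.inner_def]
  have hint : ∀ a m, Integrable (fun w => (inner ℝ
      (valueMap P (tensorRow C a m) (G m) w) (V a w) : ℝ)) P :=
    fun a m => L2.integrable_inner _ _
  simp_rw [← integral_finsetSum _ fun m _ => hint _ m]
  rw [← integral_finsetSum _ fun a _ => integrable_finsetSum _ fun m _ => hint a m, form]
  refine integral_congr_ae ?_
  filter_upwards [ae_all_iff.2 fun a => ae_all_iff.2 fun m =>
    valueMap_ae (tensorRow C a m) (G m)] with w hw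
  refine Finset.sum_congr rfl fun a _ => ?_
  rw [Finset.sum_comm]
  refine Finset.sum_congr rfl fun m _ => ?_
  rw [hw a m, PiLp.inner_apply]
  refine Finset.sum_congr rfl fun b _ => ?_
  rw [tensorRow_apply, RCLike.inner_apply, conj_trivial, Finset.mul_sum]
  exact Finset.sum_congr rfl fun n _ => by ring

theorem tensorRow_of_isIsotropic {C : Tensor4} (hiso : C.IsIsotropic) :
    ∃ c1 c2 : ℝ, ∀ a m x, tensorRow C a m x = (c1 * x m) • stdVec a +
      c2 • ((if a = m then (1 : ℝ) else 0) • x + x a • stdVec m) := by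
  obtain ⟨c1, c2, h⟩ := hiso
  refine ⟨c1, c2 / 2, fun a m x => ?_⟩
  ext b
  -- Isotropy is evaluated at the matrix whose only nonzero row is row `m`, equal to `x`.
  have := congrFun (congrFun (h (Matrix.of fun i j => if i = m then x j else 0)) a) b
  simp only [Tensor4.act, Matrix.of_apply, mul_ite, mul_zero, Finset.sum_ite_irrel,
    Finset.sum_const_zero, Finset.sum_ite_eq', Finset.mem_univ, if_true, Matrix.add_apply,
    Matrix.smul_apply, Matrix.transpose_apply, Matrix.trace, Matrix.diag_apply, smul_eq_mul,
    Matrix.one_apply] at this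
  rw [tensorRow_apply, this]
  simp only [stdVec, PiLp.add_apply, PiLp.smul_apply, smul_eq_mul, PiLp.single_apply]
  clear h this
  by_cases h1 : b = a
  · subst h1
    by_cases h2 : b = m
    · subst h2
      simp only [if_true]
      ring
    · simp only [h2, if_true, if_false]
      ring
  · have h1' : a ≠ b := fun e => h1 e.symm
    by_cases h3 : b = m
    · subst h3
      simp only [h1, h1', if_true, if_false]
      ring
    · simp only [h1, h1', h3, if_false]
      split_ifs <;> ring

theorem inner_stdVec_left (i : Fin 3) (x : E3) : inner ℝ (stdVec i) x = x i := by
  simp [stdVec, EuclideanSpace.inner_single_left]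

theorem isometry_coord (L : E3 ≃ₗᵢ[ℝ] E3) (i j : Fin 3) :
    L (stdVec i) j = L.symm (stdVec j) i := by
  rw [← inner_stdVec_left, ← inner_stdVec_left, real_inner_comm, ← L.symm.inner_map_map,
    L.symm_apply_apply]

theorem sum_isometry_coord_mul (L : E3 ≃ₗᵢ[ℝ] E3) (p : Fin 3) (y : E3) :
    ∑ m, L (stdVec m) p * y m = L y p := by
  conv_rhs => rw [stdVec_expansion y]
  simp [map_sum, mul_comm]

theorem sum_coord_smul (L : E3 ≃ₗᵢ[ℝ] E3) (v : E3) : ∑ q, v q • L (stdVec q) = L v := by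
  conv_rhs => rw [stdVec_expansion v]
  simp [map_sum]

/-- Rotation covariance of the isotropic tensor, arranged with `L` on one gradient only. The trace,
identity and transpose parts match separately: `t1` with `t2`, `t3` with `t4`, `t5` with `t6`. -/
theorem tensorRow_isometry {C : Tensor4} (hiso : C.IsIsotropic) (L : E3 ≃ₗᵢ[ℝ] E3) (a p : Fin 3)
    (x : E3) : ∑ m, L (stdVec m) p • tensorRow C a m (L.symm x) =
      ∑ q, L (stdVec a) q • L.symm (tensorRow C q p x) := by
  obtain ⟨c1, c2, h⟩ := tensorRow_of_isIsotropic hiso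
  simp only [h, map_add, map_smul, smul_add, Finset.sum_add_distrib]
  have t1 : ∑ m, L (stdVec m) p • (c1 * L.symm x m) • stdVec a = (c1 * x p) • stdVec a := by
    rw [← L.apply_symm_apply x, ← sum_isometry_coord_mul L p, L.apply_symm_apply, Finset.mul_sum,
      Finset.sum_smul]
    exact Finset.sum_congr rfl fun m _ => by rw [smul_smul]; ring_nf
  have t2 : ∑ q, L (stdVec a) q • (c1 * x p) • L.symm (stdVec q) = (c1 * x p) • stdVec a := by
    simp_rw [smul_comm _ (c1 * x p)]
    rw [← Finset.smul_sum, sum_coord_smul L.symm, L.symm_apply_apply]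
  have t3 : ∑ m, L (stdVec m) p • c2 • (if a = m then (1 : ℝ) else 0) • L.symm x =
      L (stdVec a) p • c2 • L.symm x := by
    simp
  have t4 : ∑ q, L (stdVec a) q • c2 • (if q = p then (1 : ℝ) else 0) • L.symm x =
      L (stdVec a) p • c2 • L.symm x := by
    simp
  have t5 : ∑ m, L (stdVec m) p • c2 • L.symm x a • stdVec m =
      c2 • L.symm x a • L.symm (stdVec p) := by
    simp_rw [smul_comm _ c2, smul_comm _ (L.symm x a), isometry_coord L]
    rw [← Finset.smul_sum, ← Finset.smul_sum, ← stdVec_expansion]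
  have t6 : ∑ q, L (stdVec a) q • c2 • x q • L.symm (stdVec p) =
      c2 • L.symm x a • L.symm (stdVec p) := by
    simp_rw [smul_comm _ c2, smul_smul _ (x _), isometry_coord L]
    rw [← Finset.smul_sum, ← Finset.sum_smul, sum_isometry_coord_mul L.symm]
  rw [t1, t2, t3, t4, t5, t6]

/-! ### Symmetrised vector fields -/

/-- The value part of the symmetrisation, as a continuous linear map. -/
def isoCLM (L : E3 ≃ₗᵢ[ℝ] E3) : E3 →L[ℝ] E3 := L.toContinuousLinearEquiv

theorem isoCLM_apply (L : E3 ≃ₗᵢ[ℝ] E3) (x : E3) : isoCLM L x = L x := rfl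

theorem adjoint_isoCLM (L : E3 ≃ₗᵢ[ℝ] E3) :
    ContinuousLinearMap.adjoint (isoCLM L) = isoCLM L.symm := by
  symm
  rw [ContinuousLinearMap.eq_adjoint_iff]
  intro x y
  rw [isoCLM_apply, isoCLM_apply, ← L.inner_map_map, L.apply_symm_apply]

/-- Symmetrisation of a vector field: the conditional expectation given the inclusion at the
origin, transported by the isometry `L`. -/
def symmField {L : E3 ≃ₗᵢ[ℝ] E3} (hL : IsShapeInvariant P L) (u : L2 P) : L2 P :=
  valueMap P (isoCLM L.symm) (symmetrise hL u)

/-- The gradient of the symmetrisation of a vector field. -/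
def symmGrad {L : E3 ≃ₗᵢ[ℝ] E3} (hL : IsShapeInvariant P L) (U : Fin 3 → L2 P) (m : Fin 3) : L2 P :=
  valueMap P (isoCLM L.symm) (∑ p, L (stdVec m) p • symmetrise hL (U p))

theorem symmField_mem {L : E3 ≃ₗᵢ[ℝ] E3} (hL : IsShapeInvariant P L) {u : L2 P}
    (hu : u ∈ L2zero P) : symmField hL u ∈ L2zero P :=
  valueMap_mem_L2zero _ (symmetrise_mem_L2zero hL hu)

theorem inner_symmField_left {L : E3 ≃ₗᵢ[ℝ] E3} (hL : IsShapeInvariant P L) (u v : L2 P) :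
    inner ℝ (symmField hL u) v = inner ℝ u (symmField hL.symm v) := by
  rw [symmField, inner_valueMap_left, inner_symmetrise_left, adjoint_isoCLM, symmField,
    valueMap_symmetrise]

theorem valueMap_comp {α : Type*} [MeasurableSpace α] {μ : Measure α} (A B : E3 →L[ℝ] E3)
    (u : Lp E3 2 μ) : valueMap μ A (valueMap μ B u) = valueMap μ (A.comp B) u := by
  refine Lp.ext ?_
  filter_upwards [valueMap_ae A (valueMap μ B u), valueMap_ae B u, valueMap_ae (A.comp B) u]
    with w h1 h2 h3
  rw [h1, h2, h3]
  rfl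

theorem valueMap_sum_smul {α : Type*} [MeasurableSpace α] {μ : Measure α} (c : Fin 3 → ℝ)
    (A : Fin 3 → E3 →L[ℝ] E3) (u : Lp E3 2 μ) :
    valueMap μ (∑ q, c q • A q) u = ∑ q, c q • valueMap μ (A q) u := by
  simp only [valueMap, Fin.sum_univ_three, ContinuousLinearMap.add_compLpL,
    ContinuousLinearMap.smul_compLpL, _root_.add_apply, _root_.smul_apply]

/-- Once the symmetrisation is moved onto `V`, both sides pair a linear image of `U p` with the same
field, and the linear maps agree by `tensorRow_isometry`. -/
theorem form_symmGrad {C : Tensor4} (hiso : C.IsIsotropic) {L : E3 ≃ₗᵢ[ℝ] E3}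
    (hL : IsShapeInvariant P L) (U V : Fin 3 → L2 P) :
    form P C (symmGrad hL U) V = form P C U (symmGrad hL.symm V) := by
  have lhs : form P C (symmGrad hL U) V = ∑ a, ∑ p, inner ℝ
      (valueMap P (∑ m, L (stdVec m) p • (tensorRow C a m).comp (isoCLM L.symm)) (U p))
      (symmetrise hL.symm (V a)) := by
    rw [form_eq_sum_inner]
    refine Finset.sum_congr rfl fun a _ => ?_
    simp only [symmGrad, valueMap_sum_smul, sum_inner, map_sum, map_smul]
    rw [Finset.sum_comm]
    refine Finset.sum_congr rfl fun p _ => Finset.sum_congr rfl fun m _ => ?_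
    rw [real_inner_smul_left, real_inner_smul_left, valueMap_comp, valueMap_symmetrise,
      inner_symmetrise_left]
  have rhs : form P C U (symmGrad hL.symm V) = ∑ a, ∑ p, inner ℝ
      (valueMap P (∑ q, L (stdVec a) q • (isoCLM L.symm).comp (tensorRow C q p)) (U p))
      (symmetrise hL.symm (V a)) := by
    rw [form_eq_sum_inner]
    simp only [symmGrad, valueMap_sum_smul, sum_inner, map_sum, map_smul, inner_sum]
    rw [Finset.sum_comm]
    conv_rhs => rw [Finset.sum_comm]
    refine Finset.sum_congr rfl fun p _ => ?_
    rw [Finset.sum_comm]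
    refine Finset.sum_congr rfl fun a _ => Finset.sum_congr rfl fun q _ => ?_
    rw [real_inner_smul_left, real_inner_smul_right, ← valueMap_comp, isometry_coord L,
      inner_valueMap_left (isoCLM L.symm), adjoint_isoCLM]
  rw [lhs, rhs]
  refine Finset.sum_congr rfl fun a _ => Finset.sum_congr rfl fun p _ => ?_
  congr 3
  ext1 x
  simpa [_root_.sum_apply, isoCLM_apply] using tensorRow_isometry hiso L a p x

variable [IsProbabilityMeasure P]

theorem HasGrad.symmField (hP : IsStationaryLaw P) {L : E3 ≃ₗᵢ[ℝ] E3} (hL : IsShapeInvariant P L)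
    {u : L2 P} {U : Fin 3 → L2 P} (h : HasGrad P u U) (hu : u ∈ L2zero P) :
    HasGrad P (symmField hL u) (symmGrad hL U) := by
  refine IsWeakLocalGrad.hasGrad hP (symmField_mem hL hu) (fun m => ?_)
    (((h.isWeakLocalGrad hP hu).symmetrise hP hL).valueMap hP _)
  refine valueMap_mem_L2zero _ (Submodule.sum_mem _ fun p _ => Submodule.smul_mem _ _ ?_)
  exact symmetrise_mem_L2zero hL (h.mem_L2zero hP hu p)

theorem symmField_constInclusion {L : E3 ≃ₗᵢ[ℝ] E3} (hL : IsShapeInvariant P L) (c : E3) :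
    symmField hL (constInclusion P c) = constInclusion P (L.symm c) := by
  rw [RandomElasticity.symmField, symmetrise_constInclusion, valueMap_constInclusion, isoCLM_apply]

/-- Every test field `v` is exchanged for its symmetrisation by `L⁻¹`, which is again admissible; so
the operator commutes with the symmetrisation. -/
theorem MicroOperator.symmField (hP : IsStationaryLaw P) {C : Tensor4} (hiso : C.IsIsotropic)
    {L : E3 ≃ₗᵢ[ℝ] E3} (hL : IsShapeInvariant P L) {u f : L2zero P}
    (h : MicroOperator P C u f) :
    MicroOperator P C ⟨symmField hL u, symmField_mem hL u.2⟩
      ⟨symmField hL f, symmField_mem hL f.2⟩ := by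
  obtain ⟨G, hG, hform⟩ := h
  refine ⟨symmGrad hL G, hG.symmField hP hL u.2, fun v V hV => ?_⟩
  rw [form_symmGrad hiso, hform ⟨_, symmField_mem hL.symm v.2⟩ _ (hV.symmField hP hL.symm v.2)]
  exact (inner_symmField_left hL (f : L2 P) (v : L2 P)).symm

/-! ### The mean of the solutions of the cell problem -/

theorem constInclusion_mem (c : E3) : constInclusion P c ∈ L2zero P := by
  change ∀ᵐ w ∂P, (0 : E3) ∉ w.set → constInclusion P c w = 0
  filter_upwards [constInclusion_ae (P := P) c] with w h1 h0
  rw [h1, indicator_of_notMem (show w ∉ {w : X.Config | (0 : E3) ∈ w.set} from h0)]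

theorem constInclusion_neg (c : E3) : constInclusion P (-c) = -constInclusion P c := by
  have h := valueMap_constInclusion (P := P) (-ContinuousLinearMap.id ℝ E3) c
  rw [_root_.neg_apply, ContinuousLinearMap.id_apply] at h
  rw [← h]
  refine Lp.ext ?_
  filter_upwards [valueMap_ae (-ContinuousLinearMap.id ℝ E3) (constInclusion P c),
    Lp.coeFn_neg (constInclusion P c)] with w h1 h2
  rw [h1, h2]
  rfl

/-- The mean of the component along `e'` of the field obtained from the constant load `e` by means
of the resolvent `R`. -/
def meanResponse (R : L2zero P →L[ℝ] L2zero P) (e e' : E3) : ℝ :=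
  inner ℝ (constInclusion P e') (R ⟨constInclusion P e, constInclusion_mem e⟩ : L2 P)

theorem meanResponse_neg_left (R : L2zero P →L[ℝ] L2zero P) (e e' : E3) :
    meanResponse R (-e) e' = -meanResponse R e e' := by
  have : (⟨constInclusion P (-e), constInclusion_mem _⟩ : L2zero P) =
      -⟨constInclusion P e, constInclusion_mem e⟩ := Subtype.ext (constInclusion_neg e)
  rw [meanResponse, this, map_neg, Submodule.coe_neg, inner_neg_right]
  rfl

theorem meanResponse_neg_right (R : L2zero P →L[ℝ] L2zero P) (e e' : E3) :
    meanResponse R e (-e') = -meanResponse R e e' := by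
  rw [meanResponse, constInclusion_neg, inner_neg_left]
  rfl

/-- The symmetrised solution for the load `L e` solves the problem for the load `e`, hence equals
its resolvent image. In the pairing with `e'` the symmetrisation moves to the constant field and
turns `e'` into `L e'`. -/
theorem meanResponse_isometry (hP : IsStationaryLaw P) {C : Tensor4} (hiso : C.IsIsotropic)
    {L : E3 ≃ₗᵢ[ℝ] E3} (hL : IsShapeInvariant P L) {lam : ℝ} {R : L2zero P →L[ℝ] L2zero P}
    (hR : ∀ u f : L2zero P, MicroOperator P C u (f + lam • u) ↔ u = R f) (e e' : E3) :
    meanResponse R (L e) (L e') = meanResponse R e e' := by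
  have h1 := (hR _ ⟨constInclusion P (L e), constInclusion_mem _⟩).2 rfl
  have h2 := h1.symmField hP hiso hL
  set u := R ⟨constInclusion P (L e), constInclusion_mem _⟩ with hu
  have h3 : (⟨symmField hL u, symmField_mem hL u.2⟩ : L2zero P) =
      R ⟨constInclusion P e, constInclusion_mem e⟩ := by
    rw [← hR]
    convert h2 using 1
    refine Subtype.ext ?_
    have e1 := symmField_constInclusion hL (L e)
    rw [L.symm_apply_apply] at e1
    change constInclusion P e + lam • symmField hL u =
      symmField hL (constInclusion P (L e) + lam • (u : L2 P))
    rw [← e1]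
    simp only [symmField, map_add, map_smul]
  rw [meanResponse, meanResponse, ← h3, ← hu]
  change _ = inner ℝ (constInclusion P e') (symmField hL (u : L2 P))
  have e2 := symmField_constInclusion hL.symm e'
  rw [real_inner_comm, real_inner_comm (symmField hL (u : L2 P)), inner_symmField_left, e2]
  rfl

theorem cellSolution_eq {C : Tensor4} {lam : ℝ} {R : L2zero P →L[ℝ] L2zero P}
    (hR : ∀ u f : L2zero P, MicroOperator P C u (f + lam • u) ↔ u = R f) (i : Fin 3) :
    cellSolution P C lam i = R ⟨constInclusion P (stdVec i), constInclusion_mem _⟩ := by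
  have iff : ∀ u : L2zero P, IsCellSolution P C lam i u ↔
      u = R ⟨constInclusion P (stdVec i), constInclusion_mem _⟩ := by
    intro u
    rw [← hR u]
    refine exists_congr fun G => and_congr_right fun _ => ?_
    refine forall_congr' fun v => forall_congr' fun V => imp_congr_right fun _ => ?_
    rw [Submodule.coe_add, Submodule.coe_smul, inner_add_left, real_inner_smul_left,
      inner_constInclusion v.2, add_comm]
  have hex : ∃ u, IsCellSolution P C lam i u := ⟨_, (iff _).2 rfl⟩
  rw [cellSolution, dif_pos hex]
  exact (iff _).1 hex.choose_spec

theorem betaMatrix_apply {C : Tensor4} {lam : ℝ} {R : L2zero P →L[ℝ] L2zero P}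
    (hR : ∀ u f : L2zero P, MicroOperator P C u (f + lam • u) ↔ u = R f) (j i : Fin 3) :
    betaMatrix P C lam j i = lam * (1 : Matrix (Fin 3) (Fin 3) ℝ) j i +
      lam ^ 2 * meanResponse R (stdVec i) (stdVec j) := by
  have hb : meanResponse R (stdVec i) (stdVec j) =
      ∫ w, (cellSolution P C lam i : L2 P) w j ∂P := by
    rw [meanResponse, inner_constInclusion (Subtype.mem _), ← cellSolution_eq hR i]
    simp only [inner_stdVec_left]
  have hint : Integrable (fun w => (cellSolution P C lam i : L2 P) w j) P := by
    have := ((Lp.memLp (cellSolution P C lam i : L2 P)).integrable (by norm_num)).const_inner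
      (𝕜 := ℝ) (stdVec j)
    simpa only [inner_stdVec_left] using this
  rw [hb, betaMatrix, Matrix.of_apply, integral_add (integrable_const _) (hint.const_mul _)]
  simp only [integral_const, probReal_univ, one_smul]
  rw [integral_const_mul]

/-! ### Orthogonal matrices -/

theorem exists_isometry_of_orthogonal {M : Matrix (Fin 3) (Fin 3) ℝ}
    (hM : M.transpose * M = 1) : ∃ L : E3 ≃ₗᵢ[ℝ] E3, ∀ x, matAct M x = L x := by
  have hM' : M * M.transpose = 1 := mul_eq_one_comm.1 hM
  let e : E3 ≃ₗ[ℝ] E3 :=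
    { toFun := matAct M
      invFun := matAct M.transpose
      map_add' := fun x y => by simp [matAct, Matrix.mulVec_add]
      map_smul' := fun c x => by simp [matAct, Matrix.mulVec_smul]
      left_inv := fun x => by simp [matAct, hM]
      right_inv := fun x => by simp [matAct, hM'] }
  refine ⟨⟨e, fun x => ?_⟩, fun x => rfl⟩
  have hsq : ∀ x : E3, ‖x‖ ^ 2 = x.ofLp ⬝ᵥ x.ofLp := fun x => by
    rw [EuclideanSpace.real_norm_sq_eq, dotProduct]
    exact Finset.sum_congr rfl fun i _ => sq _
  rw [← sq_eq_sq₀ (norm_nonneg _) (norm_nonneg _), hsq, hsq]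
  change (M.mulVec x.ofLp) ⬝ᵥ (M.mulVec x.ofLp) = _
  rw [Matrix.dotProduct_mulVec, Matrix.vecMul_mulVec, hM, Matrix.vecMul_one]

theorem reflection_orthogonal (j : Fin 3) : (reflection j).transpose * reflection j = 1 := by
  rw [reflection, Matrix.diagonal_transpose, Matrix.diagonal_mul_diagonal, ← Matrix.diagonal_one]
  congr 1
  ext i
  split_ifs <;> norm_num

theorem quarterTurn_orthogonal (j : Fin 3) : (quarterTurn j).transpose * quarterTurn j = 1 := by
  fin_cases j <;> ext a b <;> fin_cases a <;> fin_cases b <;>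
    simp [quarterTurn, Matrix.mul_apply, Fin.sum_univ_three]

theorem matAct_reflection (j i : Fin 3) :
    matAct (reflection j) (stdVec i) = if i = j then -stdVec i else stdVec i := by
  ext k
  by_cases h : i = j
  · subst h
    by_cases hk : k = i <;> simp [matAct, reflection, stdVec, hk]
  · by_cases hk : k = i
    · subst hk
      simp [matAct, reflection, stdVec, h]
    · simp [matAct, reflection, stdVec, h, hk]

theorem matAct_quarterTurn (j : Fin 3) :
    matAct (quarterTurn j) (stdVec j) = stdVec j ∧
      matAct (quarterTurn j) (stdVec (j + 1)) = stdVec (j + 2) ∧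
      matAct (quarterTurn j) (stdVec (j + 2)) = -stdVec (j + 1) := by
  refine ⟨?_, ?_, ?_⟩ <;> fin_cases j <;> ext k <;> fin_cases k <;>
    simp [matAct, quarterTurn, stdVec]

end

end RandomElasticity

end

/-! ### Conclusion for reflections and quarter turns. -/

theorem proposition6p1 (X : InclusionSpace) (P : Measure X.Config) [IsProbabilityMeasure P]
    (hstat : IsStationaryLaw P) (herg : IsErgodic P) (hshape : FinitelyManyShapes P)
    (C : Tensor4) (hC : C.IsElastic) (hiso : C.IsIsotropic)
    (lam : ℝ) (hlam : 0 ≤ lam) (hspec : lam ∉ microSpectrum P C) :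
    ((∀ j : Fin 3, HasMicroSymmetry P (reflection j)) → (betaMatrix P C lam).IsDiag) ∧
    ((∀ j : Fin 3, HasMicroSymmetry P (quarterTurn j)) →
      ∃ c : ℝ, betaMatrix P C lam = c • (1 : Matrix (Fin 3) (Fin 3) ℝ)) := by
  obtain ⟨R, hR⟩ : lam ∈ microResolventSet P C := by simpa [microSpectrum] using hspec
  have inv : ∀ M : Matrix (Fin 3) (Fin 3) ℝ, M.transpose * M = 1 → HasMicroSymmetry P M →
      ∀ e e' : E3, meanResponse R (matAct M e) (matAct M e') = meanResponse R e e' := by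
    intro M hM hsym e e'
    obtain ⟨L, hL⟩ := exists_isometry_of_orthogonal hM
    rw [hL, hL]
    exact meanResponse_isometry hstat hiso (hsym.isShapeInvariant hL) hR e e'
  constructor
  · intro hsym j i hji
    -- Only one of the two vectors changes sign, so the response equals its negative.
    have h := inv _ (reflection_orthogonal j) (hsym j) (stdVec i) (stdVec j)
    rw [matAct_reflection, matAct_reflection, if_neg hji.symm, if_pos rfl,
      meanResponse_neg_right] at h
    rw [betaMatrix_apply hR, Matrix.one_apply_ne hji]
    have h0 : meanResponse R (stdVec i) (stdVec j) = 0 := by linarith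
    rw [h0]
    ring
  · intro hsym
    have rot := fun j => inv _ (quarterTurn_orthogonal j) (hsym j)
    have diag : ∀ j : Fin 3, meanResponse R (stdVec (j + 1)) (stdVec (j + 1)) =
        meanResponse R (stdVec (j + 2)) (stdVec (j + 2)) := fun j => by
      have h := rot j (stdVec (j + 1)) (stdVec (j + 1))
      rw [(matAct_quarterTurn j).2.1] at h
      exact h.symm
    -- Indices are modulo three. The turn about axis `j` fixes `e_j` and maps `e_{j+1}` to `e_{j+2}`
    -- and `e_{j+2}` to `-e_{j+1}`, so the two responses equal each other and also each other's
    -- negatives.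
    have off : ∀ j : Fin 3, meanResponse R (stdVec (j + 1)) (stdVec j) = 0 ∧
        meanResponse R (stdVec (j + 2)) (stdVec j) = 0 := fun j => by
      have h1 := rot j (stdVec (j + 1)) (stdVec j)
      have h2 := rot j (stdVec (j + 2)) (stdVec j)
      rw [(matAct_quarterTurn j).1, (matAct_quarterTurn j).2.1] at h1
      rw [(matAct_quarterTurn j).1, (matAct_quarterTurn j).2.2, meanResponse_neg_left] at h2
      constructor <;> linarith
    refine ⟨lam + lam ^ 2 * meanResponse R (stdVec 0) (stdVec 0), ?_⟩
    ext j i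
    rw [betaMatrix_apply hR, Matrix.smul_apply, smul_eq_mul]
    have d0 := diag 0
    have d1 := diag 1
    have o0 := off 0
    have o1 := off 1
    have o2 := off 2
    fin_cases j <;> fin_cases i <;> simp at * <;> simp [*]
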